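/- Let $(M^{2n},\bar\omega)$ be a compact symplectic manifold (without boundary) and let $J$ be a smooth almost complex structure on $M$ compatible with $\bar\omega$, i.e. $\bar\omega(X,JX)>0$ for $0\neq X\in TM$ ($\bar\omega$ tames $J$) and $\bar\omega(JX,JY)=\bar\omega(X,Y)$. For $\psi\in C^\infty(M,\mathbb R)$ put $d^c\psi=\sqrt{-1}(\bar\partial\psi-\partial\psi)=-d\psi\circ J$ and $\bar\omega_\psi=\bar\omega+dd^c\psi$, and let $$\mathcal H=\{\rho\in C^\infty(M,\mathbb R)\;:\;\bar\omega_\rho \text{ tames } J\}.$$ For $\rho\in\mathcal H$ let $\bar g_\rho$ be the Riemannian metric $\bar g_\rho(X,Y)=\tfrac12\big(\bar\omega_\rho(X,JY)+\bar\omega_\rho(Y,JX)\big)$. Let $\Sigma$ be a closed (compact, boundaryless) smooth surface and $F:\Sigma\to M$ a smooth immersion, and let $\mathcal A(\rho)=\int_\Sigma d\mu_\rho$ be the area of $\Sigma$ with respect to the induced metric $F^*\bar g_\rho$. Call $\rho\in\mathcal H$ a compatible stable point of $\mathcal A$ if $J$ is compatible with $\bar\omega_\rho$ and $$\frac{d^2}{dt^2}\Big|_{t=0}\mathcal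 A(\phi(t))\ge 0$$ for every smooth curve $\phi:(-\varepsilon,\varepsilon)\to\mathcal H$, $\varepsilon>0$, with $\phi(0)=\rho$ (smooth meaning that $(t,x)\mapsto\phi(t)(x)$ is smooth on $(-\varepsilon,\varepsilon)\times M$). Theorem. If $\mathcal A$ has a compatible stable point $\rho\in\mathcal H$, then $F$ is $J$-holomorphic: for every $p\in\Sigma$, $J_{F(p)}$ maps $dF_p(T_p\Sigma)$ onto itself. -/

import Mathlib

open scoped Manifold ContDiff

noncomputable section

namespace SymplecticArea

/-- The model space `ℝᵐ` with its Euclidean structure. -/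
abbrev Eu (m : ℕ) : Type := EuclideanSpace ℝ (Fin m)

section Forms

variable {m : ℕ} {M : Type*} [TopologicalSpace M] [ChartedSpace (Eu m) M]

/-- A (not necessarily smooth) differential `k`-form on the `m`-manifold `M`: an alternating
`k`-linear form on every tangent space. -/
abbrev DiffForm (m k : ℕ) (M : Type*) [TopologicalSpace M] [ChartedSpace (Eu m) M] : Type _ :=
  ∀ x : M, TangentSpace (𝓡 m) x [⋀^Fin k]→L[ℝ] ℝ

/-- The coordinate expression of a form in the chart `φ` at `x₀`, that is the pull-back
`(φ⁻¹)^* θ`; it is meaningful on the target of `φ`, an open subset of `ℝᵐ`. -/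
def DiffForm.inChart {k : ℕ} (θ : DiffForm m k M) (x₀ : M) (y : Eu m) : Eu m [⋀^Fin k]→L[ℝ] ℝ :=
  (θ ((extChartAt (𝓡 m) x₀).symm y)).compContinuousLinearMap
    (mfderiv 𝓘(ℝ, Eu m) (𝓡 m) (extChartAt (𝓡 m) x₀).symm y)

/-- A form is smooth if all its coordinate expressions are. -/
def DiffForm.IsSmooth {k : ℕ} (θ : DiffForm m k M) : Prop :=
  ∀ x₀ : M, ContDiffOn ℝ ∞ (θ.inChart x₀) (extChartAt (𝓡 m) x₀).target

/-- The exterior derivative `dθ`: at `x` it is `φ^* d((φ⁻¹)^* θ)`, for the chart `φ` at `x`.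
For a `1`-form, `dθ(X, Y) = X θ(Y) - Y θ(X) - θ([X, Y])`. -/
def DiffForm.d {k : ℕ} (θ : DiffForm m k M) : DiffForm m (k + 1) M := fun x =>
  (extDeriv (θ.inChart x) (extChartAt (𝓡 m) x x)).compContinuousLinearMap
    (mfderiv (𝓡 m) 𝓘(ℝ, Eu m) (extChartAt (𝓡 m) x) x)

/-- A symplectic form: a smooth, closed, nondegenerate `2`-form. -/
structure IsSymplectic (Ω : DiffForm m 2 M) : Prop where
  smooth : Ω.IsSmooth
  closed : Ω.d = 0
  nondegenerate : ∀ (x : M) (u : TangentSpace (𝓡 m) x), (∀ v, Ω x ![u, v] = 0) → u = 0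

/-- A field of endomorphisms of the tangent bundle. -/
abbrev EndField (m : ℕ) (M : Type*) [TopologicalSpace M] [ChartedSpace (Eu m) M] : Type _ :=
  ∀ x : M, TangentSpace (𝓡 m) x →L[ℝ] TangentSpace (𝓡 m) x

/-- An almost complex structure: a smooth section `J` of `End(TM)` with `J² = -1`. -/
structure IsAlmostComplex [IsManifold (𝓡 m) ∞ M] (J : EndField m M) : Prop where
  smooth : ContMDiff (𝓡 m) ((𝓡 m).prod 𝓘(ℝ, Eu m →L[ℝ] Eu m)) ∞
    (fun x => Bundle.TotalSpace.mk' (Eu m →L[ℝ] Eu m)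
      (E := fun x : M => TangentSpace (𝓡 m) x →L[ℝ] TangentSpace (𝓡 m) x) x (J x))
  sq : ∀ (x : M) (v : TangentSpace (𝓡 m) x), J x (J x v) = -v

/-- `Ω` tames `J`: `Ω(X, JX) > 0` for `X ≠ 0`. -/
def Tames (Ω : DiffForm m 2 M) (J : EndField m M) : Prop :=
  ∀ (x : M) (v : TangentSpace (𝓡 m) x), v ≠ 0 → 0 < Ω x ![v, J x v]

/-- `J` is compatible with `Ω`: `Ω` tames `J` and `Ω(JX, JY) = Ω(X, Y)`. -/
structure IsCompatible (Ω : DiffForm m 2 M) (J : EndField m M) : Prop where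
  tames : Tames Ω J
  invariant : ∀ (x : M) (u v : TangentSpace (𝓡 m) x), Ω x ![J x u, J x v] = Ω x ![u, v]

/-- The `1`-form `d^c ψ = i(∂̄ψ - ∂ψ)`. As the `(1,0)` and `(0,1)` parts of `dψ` are
`∂ψ = (dψ - i dψ ∘ J)/2` and `∂̄ψ = (dψ + i dψ ∘ J)/2`, this is `-dψ ∘ J`. -/
def dc (J : EndField m M) (ψ : M → ℝ) : DiffForm m 1 M := fun x =>
  ContinuousAlternatingMap.ofSubsingleton ℝ (TangentSpace (𝓡 m) x) ℝ (0 : Fin 1)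
    (-((mfderiv (𝓡 m) 𝓘(ℝ, ℝ) ψ x : TangentSpace (𝓡 m) x →L[ℝ] ℝ).comp (J x)))

/-- The `2`-form `Ω_ρ = Ω + d d^c ρ`. -/
def deform (Ω : DiffForm m 2 M) (J : EndField m M) (ρ : M → ℝ) : DiffForm m 2 M := fun x =>
  Ω x + (dc J ρ).d x

/-- The space `ℋ` of potentials: smooth functions `ρ` such that `Ω + d d^c ρ` tames `J`. -/
def Potentials (Ω : DiffForm m 2 M) (J : EndField m M) : Set (M → ℝ) :=
  {ρ | ContMDiff (𝓡 m) 𝓘(ℝ, ℝ) ∞ ρ ∧ Tames (deform Ω J ρ) J}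

/-- The symmetric form `g(X, Y) = (Ω(X, JY) + Ω(Y, JX)) / 2`; it is a Riemannian metric
if `Ω` tames `J`. -/
def metric (Ω : DiffForm m 2 M) (J : EndField m M) (x : M) (u v : TangentSpace (𝓡 m) x) : ℝ :=
  (1 / 2) * (Ω x ![u, J x v] + Ω x ![v, J x u])

end Forms

section Area

variable {m : ℕ} {M : Type*} [TopologicalSpace M] [ChartedSpace (Eu m) M]
  {S : Type*} [TopologicalSpace S] [ChartedSpace (Eu 2) S]

/-- A smooth map with injective differential at every point. -/
def IsImmersion (F : S → M) : Prop :=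
  ContMDiff (𝓡 2) (𝓡 m) ∞ F ∧ ∀ p : S, Function.Injective (mfderiv (𝓡 2) (𝓡 m) F p)

/-- `F` is `J`-holomorphic: `J` maps the image of `dF` onto itself, at every point of `S`. -/
def IsJHolomorphic (J : EndField m M) (F : S → M) : Prop :=
  ∀ p : S, (LinearMap.range (mfderiv (𝓡 2) (𝓡 m) F p).toLinearMap).map (J (F p)).toLinearMap
    = LinearMap.range (mfderiv (𝓡 2) (𝓡 m) F p).toLinearMap

/-- The coefficient `(F^* g)_{ij} = g(∂F/∂x_i, ∂F/∂x_j)` of the pulled back metric `F^* g` in the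
chart of `S` at `p`, at the coordinate point `y`. -/
def gramCoeff (g : ∀ x : M, TangentSpace (𝓡 m) x → TangentSpace (𝓡 m) x → ℝ)
    (F : S → M) (p : S) (y : Eu 2) (i j : Fin 2) : ℝ :=
  g (F ((extChartAt (𝓡 2) p).symm y))
    (mfderiv 𝓘(ℝ, Eu 2) (𝓡 m) (fun z => F ((extChartAt (𝓡 2) p).symm z)) y
      (EuclideanSpace.single i (1 : ℝ)))
    (mfderiv 𝓘(ℝ, Eu 2) (𝓡 m) (fun z => F ((extChartAt (𝓡 2) p).symm z)) y
      (EuclideanSpace.single j (1 : ℝ)))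

/-- The density `√det((F^* g)_{ij})` of the area measure of `F^* g` in the chart of `S` at `p`. -/
def areaDensity (g : ∀ x : M, TangentSpace (𝓡 m) x → TangentSpace (𝓡 m) x → ℝ)
    (F : S → M) (p : S) (y : Eu 2) : ℝ :=
  Real.sqrt (Matrix.det (Matrix.of (gramCoeff g F p y)))

/-- A smooth partition of unity on the compact surface `S` subordinate to its charts. -/
def chartPartition (S : Type*) [TopologicalSpace S] [ChartedSpace (Eu 2) S]
    [IsManifold (𝓡 2) ∞ S] [T2Space S] [CompactSpace S] :
    SmoothPartitionOfUnity S (𝓡 2) S Set.univ :=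
  (SmoothPartitionOfUnity.exists_isSubordinate_chartAt_source (𝓡 2) S).choose

/-- The defining property of `chartPartition`. -/
theorem chartPartition_isSubordinate (S : Type*) [TopologicalSpace S] [ChartedSpace (Eu 2) S]
    [IsManifold (𝓡 2) ∞ S] [T2Space S] [CompactSpace S] :
    (chartPartition S).IsSubordinate (fun p => (chartAt (Eu 2) p).source) :=
  (SmoothPartitionOfUnity.exists_isSubordinate_chartAt_source (𝓡 2) S).choose_spec

variable [IsManifold (𝓡 2) ∞ S] [T2Space S] [CompactSpace S]

/-- The area of the closed surface `S` (orientable or not) in the metric `F^* g`, that is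
`∑ₚ ∫ χₚ √det((F^* g)_{ij}) dx₁ dx₂`, with a partition of unity `χ` subordinate to the charts. By
the change of variables formula it does not depend on `χ`; as `S` is compact, only finitely many
`χₚ` are nonzero. -/
def areaOf (g : ∀ x : M, TangentSpace (𝓡 m) x → TangentSpace (𝓡 m) x → ℝ) (F : S → M) : ℝ :=
  ∑ᶠ p : S, ∫ y in (extChartAt (𝓡 2) p).target,
    chartPartition S p ((extChartAt (𝓡 2) p).symm y) * areaDensity g F p y

/-- The area functional `𝒜(ρ)`: the area of `S` in the metric `F^* g_ρ`, where
`g_ρ(X, Y) = (Ω_ρ(X, JY) + Ω_ρ(Y, JX)) / 2`. -/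
def area (Ω : DiffForm m 2 M) (J : EndField m M) (F : S → M) (ρ : M → ℝ) : ℝ :=
  areaOf (metric (deform Ω J ρ) J) F

/-- A variation of `ρ` in `ℋ`: a smooth curve `t ↦ φ(t) ∈ ℋ`, `|t| < ε`, with `φ(0) = ρ`. -/
structure IsVariation (Ω : DiffForm m 2 M) (J : EndField m M) (ρ : M → ℝ) (ε : ℝ)
    (φ : ℝ → M → ℝ) : Prop where
  pos : 0 < ε
  smooth : ContMDiffOn (𝓘(ℝ, ℝ).prod (𝓡 m)) 𝓘(ℝ, ℝ) ∞ (fun q : ℝ × M => φ q.1 q.2)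
    (Set.Ioo (-ε) ε ×ˢ Set.univ)
  mem : ∀ t ∈ Set.Ioo (-ε) ε, φ t ∈ Potentials Ω J
  zero : φ 0 = ρ

/-- `ρ ∈ ℋ` is a stable point of the area functional: for every variation `φ` of `ρ` in `ℋ`,
the second derivative of `t ↦ 𝒜(φ(t))` at `0` is nonnegative. -/
def IsStablePoint (Ω : DiffForm m 2 M) (J : EndField m M) (F : S → M) (ρ : M → ℝ) : Prop :=
  ρ ∈ Potentials Ω J ∧ ∀ (ε : ℝ) (φ : ℝ → M → ℝ), IsVariation Ω J ρ ε φ →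
    0 ≤ iteratedDeriv 2 (fun t => area Ω J F (φ t)) 0

/-- A compatible stable point: a stable point `ρ` such that `J` is compatible with `Ω_ρ`. -/
def IsCompatibleStablePoint (Ω : DiffForm m 2 M) (J : EndField m M) (F : S → M) (ρ : M → ℝ) :
    Prop :=
  IsStablePoint Ω J F ρ ∧ IsCompatible (deform Ω J ρ) J

end Area

end SymplecticArea

end

/-!
Along an affine path `ρ + t ψ` of potentials the form `Ω_ρ + t dd^c ψ`, hence the metric
`g + t h` with `g = g_ρ`, is affine in `t`. On a surface the area density of `F^* (g + t h)` is the
square root of a quadratic polynomial `a + b t + c t²` with discriminant `b² - 4ac ≥ 0`, because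
`F^* g` is positive definite (`discriminant_nonneg`: a definite and an arbitrary symmetric
form are simultaneously diagonalizable). So the area density is concave in `t`, its second
derivative at `0` is `(4ac - b²) / (4 a^{3/2}) ≤ 0`, and the second derivative of the area is
negative as soon as `b² > 4ac` at one point (`second_deriv_area_neg`).

If the tangent plane `P` of the surface at `F q` is not `J`-invariant, a functional `α` vanishes on
`P` but not on `J P` (`exists_functional`). A potential `ψ` that is locally `α² / 2` in a chart
at `F q` has no differential there, and `h(u, v) = α(u) α(v) + α(J u) α(J v)` at that point
(`exists_potential`, `metric_of_hessian`). On `P` this is the square of a nonzero functional, so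
`c = 0` and `b > 0` (`discriminant_neg`): along `ρ + t ψ` the second derivative of the area is
negative, which contradicts stability.

The path stays in `ℋ` for small `t` because taming is an open condition on a compact manifold
(`Tames.eventually`). This needs `dd^c ψ` to be continuous, although it is defined with a different
chart at each point; chart independence of the exterior derivative (`DiffForm.d_inChart`) gives it.
-/

open scoped Manifold ContDiff

noncomputable section

namespace SymplecticArea

open Set Filter Topology MeasureTheory

/-! ### Charts and exterior derivatives -/

section Charts

variable {m : ℕ} {M : Type*} [TopologicalSpace M] [ChartedSpace (Eu m) M]

theorem isOpen_chart_target (x₀ : M) : IsOpen (extChartAt (𝓡 m) x₀).target := by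
  simpa using isOpen_extChartAt_target (I := 𝓡 m) x₀

/-- The differential of a map from a normed space to `M`, with values in the model space `ℝᵐ`.
All tangent spaces of `M` are definitionally `ℝᵐ`; the fixed codomain allows rewriting the base
point. -/
def modelMFDeriv {E : Type*} [NormedAddCommGroup E] [NormedSpace ℝ E] (G : E → M) (z : E) :
    E →L[ℝ] Eu m :=
  mfderiv 𝓘(ℝ, E) (𝓡 m) G z

/-- The value of a form at a point, as an alternating form on the model space `ℝᵐ`, to which the
tangent space is definitionally equal. -/
def DiffForm.val {k : ℕ} (θ : DiffForm m k M) (x : M) : Eu m [⋀^Fin k]→L[ℝ] ℝ := θ x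

theorem DiffForm.inChart_eq {k : ℕ} (θ : DiffForm m k M) (x₀ : M) (y : Eu m) :
    θ.inChart x₀ y = (θ.val ((extChartAt (𝓡 m) x₀).symm y)).compContinuousLinearMap
      (modelMFDeriv (extChartAt (𝓡 m) x₀).symm y) := rfl

variable [IsManifold (𝓡 m) ∞ M]

theorem contMDiffAt_chart_symm {x₀ : M} {y : Eu m} (hy : y ∈ (extChartAt (𝓡 m) x₀).target) :
    ContMDiffAt 𝓘(ℝ, Eu m) (𝓡 m) ∞ (extChartAt (𝓡 m) x₀).symm y :=
  (contMDiffOn_extChartAt_symm (I := 𝓡 m) (n := ∞) x₀).contMDiffAt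
    ((isOpen_chart_target x₀).mem_nhds hy)

theorem mdifferentiableAt_chart_symm {x₀ : M} {y : Eu m}
    (hy : y ∈ (extChartAt (𝓡 m) x₀).target) :
    MDifferentiableAt 𝓘(ℝ, Eu m) (𝓡 m) (extChartAt (𝓡 m) x₀).symm y :=
  (contMDiffAt_chart_symm hy).mdifferentiableAt (by simp)

theorem mfderiv_chart_comp_symm {x₀ : M} {y : Eu m} (hy : y ∈ (extChartAt (𝓡 m) x₀).target) :
    (mfderiv (𝓡 m) 𝓘(ℝ, Eu m) (extChartAt (𝓡 m) x₀) ((extChartAt (𝓡 m) x₀).symm y)).comp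
      (mfderiv 𝓘(ℝ, Eu m) (𝓡 m) (extChartAt (𝓡 m) x₀).symm y) =
      ContinuousLinearMap.id ℝ (Eu m) := by
  have h := mfderiv_extChartAt_comp_mfderivWithin_extChartAt_symm (I := 𝓡 m) hy
  simpa using! h

theorem mfderiv_chart_symm_comp {x₀ : M} {y : Eu m} (hy : y ∈ (extChartAt (𝓡 m) x₀).target) :
    (mfderiv 𝓘(ℝ, Eu m) (𝓡 m) (extChartAt (𝓡 m) x₀).symm y).comp
      (mfderiv (𝓡 m) 𝓘(ℝ, Eu m) (extChartAt (𝓡 m) x₀) ((extChartAt (𝓡 m) x₀).symm y)) =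
      ContinuousLinearMap.id ℝ (TangentSpace (𝓡 m) ((extChartAt (𝓡 m) x₀).symm y)) := by
  have h := mfderivWithin_extChartAt_symm_comp_mfderiv_extChartAt (I := 𝓡 m) hy
  simpa using! h

/-- Chain rule: the differential of a map into `M`, computed through any chart around its value. -/
theorem modelMFDeriv_eq {E : Type*} [NormedAddCommGroup E] [NormedSpace ℝ E] {G : E → M}
    {z : E} (hG : MDifferentiableAt 𝓘(ℝ, E) (𝓡 m) G z) {x₀ : M}
    (hz : G z ∈ (extChartAt (𝓡 m) x₀).source) :
    (modelMFDeriv G z : E →L[ℝ] Eu m) =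
      (modelMFDeriv (extChartAt (𝓡 m) x₀).symm (extChartAt (𝓡 m) x₀ (G z))).comp
        (fderiv ℝ (fun w => extChartAt (𝓡 m) x₀ (G w)) z) := by
  have hs : ∀ᶠ w in 𝓝 z, G w ∈ (extChartAt (𝓡 m) x₀).source :=
    hG.continuousAt.preimage_mem_nhds ((isOpen_extChartAt_source x₀).mem_nhds hz)
  have he : G =ᶠ[𝓝 z] (extChartAt (𝓡 m) x₀).symm ∘ (fun w => extChartAt (𝓡 m) x₀ (G w)) := by
    filter_upwards [hs] with w hw
    exact ((extChartAt (𝓡 m) x₀).left_inv hw).symm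
  have h1 : MDifferentiableAt 𝓘(ℝ, E) 𝓘(ℝ, Eu m) (fun w => extChartAt (𝓡 m) x₀ (G w)) z :=
    (mdifferentiableAt_extChartAt (I := 𝓡 m) (by simpa using hz)).comp z hG
  unfold modelMFDeriv
  rw [he.mfderiv_eq]
  rw [mfderiv_comp z (mdifferentiableAt_chart_symm ((extChartAt (𝓡 m) x₀).map_source hz)) h1,
    mfderiv_eq_fderiv]
  rfl

/-- The pull-back of a form by a map into `M` can be computed in any chart of `M`. -/
theorem DiffForm.pullback_eq_inChart {k : ℕ} {E : Type*} [NormedAddCommGroup E] [NormedSpace ℝ E]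
    (θ : DiffForm m k M) {G : E → M}
    {z : E} (hG : MDifferentiableAt 𝓘(ℝ, E) (𝓡 m) G z) {x₀ : M}
    (hz : G z ∈ (extChartAt (𝓡 m) x₀).source) :
    (θ.val (G z)).compContinuousLinearMap (modelMFDeriv G z) =
    (θ.inChart x₀ (extChartAt (𝓡 m) x₀ (G z))).compContinuousLinearMap
      (fderiv ℝ (fun w => extChartAt (𝓡 m) x₀ (G w)) z) := by
  rw [modelMFDeriv_eq hG hz, DiffForm.inChart_eq, (extChartAt (𝓡 m) x₀).left_inv hz]
  rfl

/-- The transition map from the chart at `x₁` to the chart at `x₀`. -/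
def transition (x₁ x₀ : M) (y : Eu m) : Eu m :=
  extChartAt (𝓡 m) x₀ ((extChartAt (𝓡 m) x₁).symm y)

theorem contDiffAt_transition {x₁ x₀ : M} {y : Eu m} (hy : y ∈ (extChartAt (𝓡 m) x₁).target)
    (hy' : (extChartAt (𝓡 m) x₁).symm y ∈ (extChartAt (𝓡 m) x₀).source) :
    ContDiffAt ℝ ∞ (transition x₁ x₀) y := by
  have h := (contMDiffAt_extChartAt' (I := 𝓡 m) (n := ∞) (x := x₀) (by simpa using hy')).comp y
    (contMDiffAt_chart_symm hy)
  exact h.contDiffAt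

theorem transition_eventually {x₁ x₀ : M} {y : Eu m} (hy : y ∈ (extChartAt (𝓡 m) x₁).target)
    (hy' : (extChartAt (𝓡 m) x₁).symm y ∈ (extChartAt (𝓡 m) x₀).source) :
    ∀ᶠ z in 𝓝 y, z ∈ (extChartAt (𝓡 m) x₁).target ∧
      (extChartAt (𝓡 m) x₁).symm z ∈ (extChartAt (𝓡 m) x₀).source :=
  ((isOpen_chart_target x₁).mem_nhds hy |> eventually_mem_set.2).and
    ((contMDiffAt_chart_symm hy).continuousAt.preimage_mem_nhds
      ((isOpen_extChartAt_source x₀).mem_nhds hy'))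

theorem DiffForm.inChart_transition {k : ℕ} (θ : DiffForm m k M) {x₁ x₀ : M} {y : Eu m}
    (hy : y ∈ (extChartAt (𝓡 m) x₁).target)
    (hy' : (extChartAt (𝓡 m) x₁).symm y ∈ (extChartAt (𝓡 m) x₀).source) :
    θ.inChart x₁ y = (θ.inChart x₀ (transition x₁ x₀ y)).compContinuousLinearMap
      (fderiv ℝ (transition x₁ x₀) y) :=
  θ.pullback_eq_inChart (mdifferentiableAt_chart_symm hy) hy'

/-- The exterior derivative, defined at each point in the chart at that point, is given by the same
formula in all charts: `extDeriv` commutes with pull-back by the transition maps. -/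
theorem DiffForm.d_inChart {k : ℕ} (θ : DiffForm m k M) (hθ : θ.IsSmooth) {x₀ : M} {y : Eu m}
    (hy : y ∈ (extChartAt (𝓡 m) x₀).target) :
    θ.d.inChart x₀ y = extDeriv (θ.inChart x₀) y := by
  set x := (extChartAt (𝓡 m) x₀).symm y with hx
  have hxs : x ∈ (extChartAt (𝓡 m) x).source := mem_extChartAt_source x
  have hτ := contDiffAt_transition (x₀ := x) hy hxs
  -- `θ.d` at `x` is defined in the chart at `x`, so the chart at `x₀` is compared with that one.
  have hev : θ.inChart x₀ =ᶠ[𝓝 y] fun z =>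
      (θ.inChart x (transition x₀ x z)).compContinuousLinearMap
        (fderiv ℝ (transition x₀ x) z) := by
    filter_upwards [transition_eventually hy hxs] with z hz
    exact θ.inChart_transition hz.1 hz.2
  have hd : DifferentiableAt ℝ (θ.inChart x) (transition x₀ x y) :=
    ((hθ x).contDiffAt ((isOpen_chart_target x).mem_nhds
      (mem_extChartAt_target x))).differentiableAt (by simp)
  rw [hev.extDeriv_eq, extDeriv_pullback hd hτ (by simp; norm_cast)]
  rw [DiffForm.inChart, DiffForm.d]
  have hfd : fderiv ℝ (transition x₀ x) y =
    (mfderiv (𝓡 m) 𝓘(ℝ, Eu m) (extChartAt (𝓡 m) x) x).comp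
      (mfderiv 𝓘(ℝ, Eu m) (𝓡 m) (extChartAt (𝓡 m) x₀).symm y) := by
    rw [← mfderiv_eq_fderiv]
    exact mfderiv_comp y (mdifferentiableAt_extChartAt (I := 𝓡 m) (mem_chart_source _ x))
      (mdifferentiableAt_chart_symm hy)
  rw [hfd]
  rfl

end Charts

/-! ### The complex structure and the forms `Ω + dd^c ρ` in charts -/

section ComplexStructure

variable {m : ℕ} {M : Type*} [TopologicalSpace M] [ChartedSpace (Eu m) M]

/-- The matrix-valued coordinate expression `dφ ∘ J ∘ dφ⁻¹` of the endomorphism field `J` in the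
chart `φ` at `x₀`; it is meaningful on the target of `φ`. -/
def chartJ (J : EndField m M) (x₀ : M) (y : Eu m) : Eu m →L[ℝ] Eu m :=
  (mfderiv (𝓡 m) 𝓘(ℝ, Eu m) (extChartAt (𝓡 m) x₀) ((extChartAt (𝓡 m) x₀).symm y)).comp
    ((J ((extChartAt (𝓡 m) x₀).symm y)).comp
      (mfderiv 𝓘(ℝ, Eu m) (𝓡 m) (extChartAt (𝓡 m) x₀).symm y))

theorem DiffForm.IsSmooth.differentiableAt {k : ℕ} {θ : DiffForm m k M} (hθ : θ.IsSmooth) {x₀ : M}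
    {y : Eu m} (hy : y ∈ (extChartAt (𝓡 m) x₀).target) : DifferentiableAt ℝ (θ.inChart x₀) y :=
  ((hθ x₀).contDiffAt ((isOpen_chart_target x₀).mem_nhds hy)).differentiableAt (by simp)

/-- A form is continuous if all its coordinate expressions are. -/
def DiffForm.IsCont {k : ℕ} (θ : DiffForm m k M) : Prop :=
  ∀ x₀ : M, ContinuousOn (θ.inChart x₀) (extChartAt (𝓡 m) x₀).target

theorem DiffForm.IsSmooth.isCont {k : ℕ} {θ : DiffForm m k M} (hθ : θ.IsSmooth) : θ.IsCont :=
  fun x₀ => (hθ x₀).continuousOn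

theorem dc_add_smul (J : EndField m M) {ρ ψ : M → ℝ} (hρ : ContMDiff (𝓡 m) 𝓘(ℝ, ℝ) ∞ ρ)
    (hψ : ContMDiff (𝓡 m) 𝓘(ℝ, ℝ) ∞ ψ) (t : ℝ) :
    dc J (fun x => ρ x + t * ψ x) = fun x => dc J ρ x + t • dc J ψ x := by
  funext x
  have h := ((hρ.mdifferentiable (by simp) x).hasMFDerivAt).add
      ((hψ.mdifferentiable (by simp) x).hasMFDerivAt.const_smul t)
  let A : Eu m →L[ℝ] ℝ := mfderiv (𝓡 m) 𝓘(ℝ, ℝ) ρ x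
  let B : Eu m →L[ℝ] ℝ := mfderiv (𝓡 m) 𝓘(ℝ, ℝ) ψ x
  let C : Eu m →L[ℝ] ℝ := mfderiv (𝓡 m) 𝓘(ℝ, ℝ) (fun x => ρ x + t * ψ x) x
  have hC : C = A + t • B := h.mfderiv
  ext v
  change -C (J x (v 0)) = -A (J x (v 0)) + t * -B (J x (v 0))
  rw [hC]
  change -(A (J x (v 0)) + t * B (J x (v 0))) = _
  ring

theorem DiffForm.d_add_smul {k : ℕ} {θ η : DiffForm m k M} (hθ : θ.IsSmooth) (hη : η.IsSmooth)
    (t : ℝ) : DiffForm.d (fun x => θ x + t • η x) = fun x => θ.d x + t • η.d x := by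
  funext x
  have h : DiffForm.inChart (fun x => θ x + t • η x) x = θ.inChart x + t • η.inChart x := rfl
  simp only [DiffForm.d]
  rw [h, extDeriv_add (hθ.differentiableAt (mem_extChartAt_target x))
    ((hη.differentiableAt (mem_extChartAt_target x)).const_smul t), extDeriv_smul]
  rfl

variable [IsManifold (𝓡 m) ∞ M]

/-- The inverse of the chart intertwines the local expression of `J` with `J`. -/
theorem modelMFDeriv_chartJ (J : EndField m M) {x₀ : M} {y : Eu m}
    (hy : y ∈ (extChartAt (𝓡 m) x₀).target) (w : Eu m) :
    (modelMFDeriv (extChartAt (𝓡 m) x₀).symm y (chartJ J x₀ y w) : Eu m) =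
      J ((extChartAt (𝓡 m) x₀).symm y) (modelMFDeriv (extChartAt (𝓡 m) x₀).symm y w) := by
  exact DFunLike.congr_fun (mfderiv_chart_symm_comp hy)
    (J ((extChartAt (𝓡 m) x₀).symm y) (modelMFDeriv (extChartAt (𝓡 m) x₀).symm y w))

theorem contDiffOn_chartJ {J : EndField m M} (hJ : IsAlmostComplex J) (x₀ : M) :
    ContDiffOn ℝ ∞ (chartJ J x₀) (extChartAt (𝓡 m) x₀).target := by
  have h := hJ.smooth.contMDiffOn (s := (chartAt (Eu m) x₀).source)
  have hb : (trivializationAt (Eu m →L[ℝ] Eu m)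
    (fun x : M => TangentSpace (𝓡 m) x →L[ℝ] TangentSpace (𝓡 m) x) x₀).baseSet =
      (chartAt (Eu m) x₀).source := by
    simp
  rw [← hb] at h
  rw [Bundle.Trivialization.contMDiffOn_section_baseSet_iff (s := fun x => J x)] at h
  rw [hb] at h
  have h2 : ContMDiffOn 𝓘(ℝ, Eu m) 𝓘(ℝ, Eu m →L[ℝ] Eu m) ∞ _ (extChartAt (𝓡 m) x₀).target :=
    h.comp (contMDiffOn_extChartAt_symm (I := 𝓡 m) (n := ∞) x₀) (fun y hy => by
      simpa using (extChartAt (𝓡 m) x₀).map_target hy)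
  rw [contMDiffOn_iff_contDiffOn] at h2
  refine h2.congr fun y hy => ?_
  have hs : (extChartAt (𝓡 m) x₀).symm y ∈ (chartAt (Eu m) x₀).source := by
    simpa using (extChartAt (𝓡 m) x₀).map_target hy
  simp only [Function.comp_apply, hom_trivializationAt_apply]
  rw [ContinuousLinearMap.inCoordinates, TangentBundle.continuousLinearMapAt_trivializationAt hs,
    TangentBundle.symmL_trivializationAt hs, (extChartAt (𝓡 m) x₀).right_inv hy,
    (𝓡 m).range_eq_univ, mfderivWithin_univ]
  rfl

/-- In a chart, `d^c ψ = -dψ ∘ J`. -/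
theorem dc_inChart (J : EndField m M) {ψ : M → ℝ} (hψ : ContMDiff (𝓡 m) 𝓘(ℝ, ℝ) ∞ ψ) {x₀ : M}
    {y : Eu m} (hy : y ∈ (extChartAt (𝓡 m) x₀).target) :
    (dc J ψ).inChart x₀ y = ContinuousAlternatingMap.ofSubsingleton ℝ (Eu m) ℝ (0 : Fin 1)
      (-((fderiv ℝ (fun z => ψ ((extChartAt (𝓡 m) x₀).symm z)) y).comp (chartJ J x₀ y))) := by
  have hD : fderiv ℝ (fun z => ψ ((extChartAt (𝓡 m) x₀).symm z)) y =
      (mfderiv (𝓡 m) 𝓘(ℝ, ℝ) ψ ((extChartAt (𝓡 m) x₀).symm y)).comp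
        (mfderiv 𝓘(ℝ, Eu m) (𝓡 m) (extChartAt (𝓡 m) x₀).symm y) := by
    rw [← mfderiv_eq_fderiv]
    exact mfderiv_comp y (hψ.mdifferentiable (by simp) _) (mdifferentiableAt_chart_symm hy)
  ext v
  rw [hD]
  have := modelMFDeriv_chartJ J hy (v 0)
  change -(mfderiv (𝓡 m) 𝓘(ℝ, ℝ) ψ ((extChartAt (𝓡 m) x₀).symm y)
    (J ((extChartAt (𝓡 m) x₀).symm y) (modelMFDeriv (extChartAt (𝓡 m) x₀).symm y (v 0)))) =
    -(mfderiv (𝓡 m) 𝓘(ℝ, ℝ) ψ ((extChartAt (𝓡 m) x₀).symm y)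
      (modelMFDeriv (extChartAt (𝓡 m) x₀).symm y (chartJ J x₀ y (v 0))))
  rw [this]

theorem contDiffOn_comp_chart_symm {ψ : M → ℝ} (hψ : ContMDiff (𝓡 m) 𝓘(ℝ, ℝ) ∞ ψ) (x₀ : M) :
    ContDiffOn ℝ ∞ (fun z => ψ ((extChartAt (𝓡 m) x₀).symm z)) (extChartAt (𝓡 m) x₀).target :=
  (hψ.comp_contMDiffOn (contMDiffOn_extChartAt_symm (I := 𝓡 m) (n := ∞) x₀)).contDiffOn

theorem dc_isSmooth {J : EndField m M} (hJ : IsAlmostComplex J) {ψ : M → ℝ}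
    (hψ : ContMDiff (𝓡 m) 𝓘(ℝ, ℝ) ∞ ψ) : (dc J ψ).IsSmooth := by
  intro x₀
  have h1 : ContDiffOn ℝ ∞ (fderiv ℝ (fun z => ψ ((extChartAt (𝓡 m) x₀).symm z)))
      (extChartAt (𝓡 m) x₀).target :=
    (contDiffOn_comp_chart_symm hψ x₀).fderiv_of_isOpen (isOpen_chart_target x₀) (by simp)
  have h2 := (h1.clm_comp (contDiffOn_chartJ hJ x₀)).neg
  have h3 := (ContinuousAlternatingMap.ofSubsingletonLIE (𝕜 := ℝ) (E := Eu m) (F := ℝ)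
    (0 : Fin 1)).toContinuousLinearEquiv.contDiff.comp_contDiffOn h2
  exact h3.congr fun y hy => dc_inChart J hψ hy

/-- The deformed form depends affinely on the potential. -/
theorem deform_add_smul (Ω : DiffForm m 2 M) {J : EndField m M} (hJ : IsAlmostComplex J)
    {ρ ψ : M → ℝ} (hρ : ContMDiff (𝓡 m) 𝓘(ℝ, ℝ) ∞ ρ)
    (hψ : ContMDiff (𝓡 m) 𝓘(ℝ, ℝ) ∞ ψ) (t : ℝ) (x : M) :
    deform Ω J (fun x => ρ x + t * ψ x) x = deform Ω J ρ x + t • (dc J ψ).d x := by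
  simp only [deform]
  rw [dc_add_smul J hρ hψ, DiffForm.d_add_smul (dc_isSmooth hJ hρ) (dc_isSmooth hJ hψ), add_assoc]

theorem DiffForm.IsSmooth.d_isCont {k : ℕ} {θ : DiffForm m k M} (hθ : θ.IsSmooth) :
    θ.d.IsCont := by
  intro x₀
  have h1 : ContinuousOn (fderiv ℝ (θ.inChart x₀)) (extChartAt (𝓡 m) x₀).target :=
    (hθ x₀).continuousOn_fderiv_of_isOpen (isOpen_chart_target x₀) (by simp)
  have h2 := (ContinuousAlternatingMap.alternatizeUncurryFinCLM ℝ (Eu m) ℝ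
    (n := k)).continuous.comp_continuousOn h1
  exact h2.congr fun y hy => θ.d_inChart hθ hy

theorem deform_isCont {Ω : DiffForm m 2 M} (hΩ : Ω.IsSmooth) {J : EndField m M}
    (hJ : IsAlmostComplex J) {ρ : M → ℝ} (hρ : ContMDiff (𝓡 m) 𝓘(ℝ, ℝ) ∞ ρ) :
    (deform Ω J ρ).IsCont := fun x₀ =>
  (hΩ.isCont x₀).add ((dc_isSmooth hJ hρ).d_isCont x₀)

end ComplexStructure

/-! ### The metric of a two-form and openness of taming -/

section Alternating

variable {E : Type*} [AddCommGroup E] [Module ℝ E] [TopologicalSpace E]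

theorem alternating_swap (β : E [⋀^Fin 2]→L[ℝ] ℝ) (u v : E) : β ![u, v] = -β ![v, u] := by
  have h := β.toAlternatingMap.map_swap ![v, u] (i := 0) (j := 1) (by decide)
  have h2 : (![v, u] ∘ ⇑(Equiv.swap (0 : Fin 2) 1)) = ![u, v] := by
    funext i; fin_cases i <;> simp
  rw [h2] at h
  exact h

theorem alternating_lin_left (β : E [⋀^Fin 2]→L[ℝ] ℝ) (a b : ℝ) (u v w : E) :
    β ![a • u + b • v, w] = a * β ![u, w] + b * β ![v, w] := by
  have h1 := β.vecCons_add ![w] (a • u) (b • v)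
  have h2 := β.vecCons_smul ![w] a u
  have h3 := β.vecCons_smul ![w] b v
  rw [h1, h2, h3]; rfl

theorem alternating_lin_right (β : E [⋀^Fin 2]→L[ℝ] ℝ) (a b : ℝ) (u v w : E) :
    β ![w, a • u + b • v] = a * β ![w, u] + b * β ![w, v] := by
  rw [alternating_swap, alternating_lin_left, alternating_swap β u, alternating_swap β v]; ring

end Alternating

section Metric

variable {m : ℕ} {M : Type*} [TopologicalSpace M] [ChartedSpace (Eu m) M]

theorem metric_symm (Θ : DiffForm m 2 M) (J : EndField m M) (x : M) (u v : TangentSpace (𝓡 m) x) :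
    metric Θ J x u v = metric Θ J x v u := by
  simp only [metric]; ring

theorem metric_self (Θ : DiffForm m 2 M) (J : EndField m M) (x : M) (v : TangentSpace (𝓡 m) x) :
    metric Θ J x v v = Θ x ![v, J x v] := by
  simp only [metric]; ring

theorem metric_lin_self (Θ : DiffForm m 2 M) (J : EndField m M) (x : M)
    (u v : TangentSpace (𝓡 m) x) (a b : ℝ) :
    metric Θ J x (a • u + b • v) (a • u + b • v) =
      a ^ 2 * metric Θ J x u u + 2 * a * b * metric Θ J x u v + b ^ 2 * metric Θ J x v v := by
  simp only [metric, map_add, map_smul, alternating_lin_left, alternating_lin_right]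
  ring

theorem metric_add_smul (Θ₀ Θ₁ : DiffForm m 2 M) (J : EndField m M) (t : ℝ) (x : M)
    (u v : TangentSpace (𝓡 m) x) :
    metric (fun x => Θ₀ x + t • Θ₁ x) J x u v = metric Θ₀ J x u v + t * metric Θ₁ J x u v := by
  simp only [metric, ContinuousAlternatingMap.add_apply, ContinuousAlternatingMap.smul_apply,
    smul_eq_mul]
  ring

theorem tames_iff_metric_pos {Θ : DiffForm m 2 M} {J : EndField m M} :
    Tames Θ J ↔ ∀ (x : M) (v : TangentSpace (𝓡 m) x), v ≠ 0 → 0 < metric Θ J x v v := by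
  simp only [Tames, metric_self]

theorem Tames.metric_lin_pos {Θ : DiffForm m 2 M} {J : EndField m M} (h : Tames Θ J) {x : M}
    {u v : TangentSpace (𝓡 m) x} {a b : ℝ} (h0 : a • u + b • v ≠ 0) :
    0 < a ^ 2 * metric Θ J x u u + 2 * a * b * metric Θ J x u v + b ^ 2 * metric Θ J x v v := by
  rw [← metric_lin_self]
  exact tames_iff_metric_pos.1 h x _ h0

/-- The Gram determinant of two linearly independent vectors is positive. -/
theorem Tames.gram_pos {Θ : DiffForm m 2 M} {J : EndField m M} (h : Tames Θ J) {x : M}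
    {u v : TangentSpace (𝓡 m) x} (huv : ∀ a b : ℝ, a • u + b • v = 0 → a = 0 ∧ b = 0) :
    0 < metric Θ J x u u * metric Θ J x v v - metric Θ J x u v ^ 2 := by
  have hu : 0 < metric Θ J x u u := tames_iff_metric_pos.1 h x u fun h0 => by
    have := (huv 1 0 (by rw [h0, smul_zero, zero_smul, add_zero])).1
    norm_num at this
  -- The squared norm of `g(u, u) v - g(u, v) u` is `g(u, u)` times the Gram determinant.
  have h1 := h.metric_lin_pos (a := -(metric Θ J x u v)) (b := metric Θ J x u u) fun h0 =>
    hu.ne' (huv _ _ h0).2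
  by_contra hc
  nlinarith

/-- The coordinate expression of `metric Θ J` in the chart at `x₀`; it is meaningful on the target
of the chart. -/
def chartMetric (Θ : DiffForm m 2 M) (J : EndField m M) (x₀ : M) (y u v : Eu m) : ℝ :=
  (1 / 2) * (Θ.inChart x₀ y ![u, chartJ J x₀ y v] + Θ.inChart x₀ y ![v, chartJ J x₀ y u])

theorem chartMetric_smul_self (Θ : DiffForm m 2 M) (J : EndField m M) (x₀ : M) (y w : Eu m)
    (c : ℝ) : chartMetric Θ J x₀ y (c • w) (c • w) = c ^ 2 * chartMetric Θ J x₀ y w w := by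
  have h := alternating_lin_left (Θ.inChart x₀ y) c 0 w 0 (chartJ J x₀ y (c • w))
  have h' := alternating_lin_right (Θ.inChart x₀ y) c 0 (chartJ J x₀ y w) 0 w
  simp only [smul_zero, add_zero, zero_mul, ← map_smul] at h h'
  simp only [chartMetric, h, h']
  ring

variable [IsManifold (𝓡 m) ∞ M]

theorem metric_chart_symm (Θ : DiffForm m 2 M) (J : EndField m M) {x₀ : M} {y : Eu m}
    (hy : y ∈ (extChartAt (𝓡 m) x₀).target) (u v : Eu m) :
    metric Θ J ((extChartAt (𝓡 m) x₀).symm y) (modelMFDeriv (extChartAt (𝓡 m) x₀).symm y u)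
      (modelMFDeriv (extChartAt (𝓡 m) x₀).symm y v) = chartMetric Θ J x₀ y u v := by
  simp only [metric, chartMetric, DiffForm.inChart_eq]
  have h : ∀ u v : Eu m, (Θ.val ((extChartAt (𝓡 m) x₀).symm y)).compContinuousLinearMap
      (modelMFDeriv (extChartAt (𝓡 m) x₀).symm y) ![u, chartJ J x₀ y v] =
      Θ ((extChartAt (𝓡 m) x₀).symm y) ![modelMFDeriv (extChartAt (𝓡 m) x₀).symm y u,
        J ((extChartAt (𝓡 m) x₀).symm y) (modelMFDeriv (extChartAt (𝓡 m) x₀).symm y v)] := by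
    intro u v
    rw [← modelMFDeriv_chartJ J hy]
    simp only [ContinuousAlternatingMap.compContinuousLinearMap_apply]
    congr 1
    funext i; fin_cases i <;> rfl
  rw [h, h]

/-- The metric on vectors tangent to a map `G` into `M`, in a chart of `M`. -/
theorem metric_modelMFDeriv {E : Type*} [NormedAddCommGroup E] [NormedSpace ℝ E]
    (Θ : DiffForm m 2 M) (J : EndField m M) {G : E → M}
    {z : E} (hG : MDifferentiableAt 𝓘(ℝ, E) (𝓡 m) G z) {x₀ : M}
    (hz : G z ∈ (extChartAt (𝓡 m) x₀).source) (a b : E) :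
    metric Θ J (G z) (modelMFDeriv G z a) (modelMFDeriv G z b) =
      chartMetric Θ J x₀ (extChartAt (𝓡 m) x₀ (G z))
        (fderiv ℝ (fun w => extChartAt (𝓡 m) x₀ (G w)) z a)
        (fderiv ℝ (fun w => extChartAt (𝓡 m) x₀ (G w)) z b) := by
  rw [← metric_chart_symm Θ J ((extChartAt (𝓡 m) x₀).map_source hz), modelMFDeriv_eq hG hz]
  rw [(extChartAt (𝓡 m) x₀).left_inv hz]
  rfl

theorem continuousAt_chartMetric {Θ : DiffForm m 2 M} (hΘ : Θ.IsCont) {J : EndField m M}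
    (hJ : IsAlmostComplex J) (x₀ : M) {X : Type*} [TopologicalSpace X] {f g h : X → Eu m} {p : X}
    (hf : ContinuousAt f p) (hg : ContinuousAt g p) (hh : ContinuousAt h p)
    (hp : f p ∈ (extChartAt (𝓡 m) x₀).target) :
    ContinuousAt (fun q => chartMetric Θ J x₀ (f q) (g q) (h q)) p := by
  have hn := (isOpen_chart_target x₀).mem_nhds hp
  have h1 : ContinuousAt (fun q => Θ.inChart x₀ (f q)) p :=
    ((hΘ x₀).continuousAt hn).comp hf
  have h2 : ContinuousAt (fun q => chartJ J x₀ (f q)) p :=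
    ((contDiffOn_chartJ hJ x₀).continuousOn.continuousAt hn).comp hf
  have key : ∀ f' g' : X → Eu m, ContinuousAt f' p → ContinuousAt g' p →
      ContinuousAt (fun q => Θ.inChart x₀ (f q) ![f' q, chartJ J x₀ (f q) (g' q)]) p := by
    intro f' g' hf' hg'
    refine h1.eval (continuousAt_pi.2 fun i => ?_)
    fin_cases i
    · exact hf'
    · exact h2.clm_apply hg'
  exact ((key _ _ hg hh).add (key _ _ hh hg)).const_smul (1 / 2 : ℝ)

/-- Every tangent vector at a point of the domain of a chart is represented in that chart. -/
theorem exists_chartMetric_eq (J : EndField m M) {x₀ x : M}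
    (hx : x ∈ (extChartAt (𝓡 m) x₀).source) (v : TangentSpace (𝓡 m) x) :
    ∃ w : Eu m, (w = 0 → v = 0) ∧ ∀ Θ : DiffForm m 2 M,
      metric Θ J x v v = chartMetric Θ J x₀ (extChartAt (𝓡 m) x₀ x) w w := by
  obtain ⟨y, hy, rfl⟩ : ∃ y ∈ (extChartAt (𝓡 m) x₀).target, (extChartAt (𝓡 m) x₀).symm y = x :=
    ⟨_, (extChartAt (𝓡 m) x₀).map_source hx, (extChartAt (𝓡 m) x₀).left_inv hx⟩
  obtain ⟨w, rfl⟩ : ∃ w : Eu m, modelMFDeriv (extChartAt (𝓡 m) x₀).symm y w = v :=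
    ⟨mfderiv (𝓡 m) 𝓘(ℝ, Eu m) (extChartAt (𝓡 m) x₀) ((extChartAt (𝓡 m) x₀).symm y) v,
      DFunLike.congr_fun (mfderiv_chart_symm_comp hy) v⟩
  refine ⟨w, fun h0 => by rw [h0, map_zero]; rfl, fun Θ => ?_⟩
  rw [(extChartAt (𝓡 m) x₀).right_inv hy]
  exact metric_chart_symm Θ J hy w w

theorem eq_zero_of_modelMFDeriv_chart_symm {x₀ : M} {y w : Eu m}
    (hy : y ∈ (extChartAt (𝓡 m) x₀).target)
    (h : (modelMFDeriv (extChartAt (𝓡 m) x₀).symm y w : Eu m) = 0) : w = 0 := by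
  have h2 := DFunLike.congr_fun (mfderiv_chart_comp_symm hy) w
  have h3 : (mfderiv (𝓡 m) 𝓘(ℝ, Eu m) (extChartAt (𝓡 m) x₀) ((extChartAt (𝓡 m) x₀).symm y))
      (modelMFDeriv (extChartAt (𝓡 m) x₀).symm y w) = 0 :=
    (congrArg (mfderiv (𝓡 m) 𝓘(ℝ, Eu m) (extChartAt (𝓡 m) x₀)
      ((extChartAt (𝓡 m) x₀).symm y)) h).trans (map_zero _)
  exact h2.symm.trans h3

/-- Local version of the openness of taming: by compactness of the unit sphere, positivity persists
for small `t` and for all base points near `x₀`. -/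
theorem Tames.eventually_pos {Θ₀ Θ₁ : DiffForm m 2 M} (h₀ : Θ₀.IsCont) (h₁ : Θ₁.IsCont)
    {J : EndField m M} (hJ : IsAlmostComplex J) (ht : Tames Θ₀ J) (x₀ : M) :
    ∀ᶠ q : ℝ × M in 𝓝 (0, x₀), ∀ v : TangentSpace (𝓡 m) q.2, v ≠ 0 →
      0 < metric Θ₀ J q.2 v v + q.1 * metric Θ₁ J q.2 v v := by
  rw [tames_iff_metric_pos] at ht
  set e := extChartAt (𝓡 m) x₀ with he
  have hxt : e x₀ ∈ e.target := mem_extChartAt_target x₀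
  have hpos : ∀ w ∈ Metric.sphere (0 : Eu m) 1, ∀ᶠ z : (ℝ × Eu m) × Eu m in 𝓝 ((0, e x₀), w),
      0 < chartMetric Θ₀ J x₀ z.1.2 z.2 z.2 + z.1.1 * chartMetric Θ₁ J x₀ z.1.2 z.2 z.2 := by
    intro w hw
    have hc : ∀ {Θ : DiffForm m 2 M}, Θ.IsCont →
        ContinuousAt (fun z : (ℝ × Eu m) × Eu m => chartMetric Θ J x₀ z.1.2 z.2 z.2)
          ((0, e x₀), w) := fun hΘ =>
      continuousAt_chartMetric hΘ hJ x₀ continuousAt_fst.snd continuousAt_snd continuousAt_snd hxt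
    have hc2 := (hc h₀).add (continuousAt_fst.fst.mul (hc h₁))
    refine hc2.eventually (lt_mem_nhds ?_)
    change 0 < chartMetric Θ₀ J x₀ (e x₀) w w + 0 * chartMetric Θ₁ J x₀ (e x₀) w w
    rw [zero_mul, add_zero, ← metric_chart_symm Θ₀ J hxt]
    refine ht _ _ fun h0 => ?_
    have h3 : w = 0 := eq_zero_of_modelMFDeriv_chart_symm hxt h0
    simp [h3] at hw
  have hev := (isCompact_sphere (0 : Eu m) 1).eventually_forall_of_forall_eventually
    (P := fun (q : ℝ × Eu m) w =>
      0 < chartMetric Θ₀ J x₀ q.2 w w + q.1 * chartMetric Θ₁ J x₀ q.2 w w) hpos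
  have hcont : ContinuousAt (fun q : ℝ × M => (q.1, e q.2)) (0, x₀) :=
    continuousAt_fst.prodMk ((continuousAt_extChartAt (I := 𝓡 m) x₀).comp continuousAt_snd)
  have hsrc : ∀ᶠ q : ℝ × M in 𝓝 (0, x₀), q.2 ∈ e.source :=
    continuousAt_snd.eventually (extChartAt_source_mem_nhds (I := 𝓡 m) x₀)
  filter_upwards [hcont.eventually hev, hsrc]
  rintro ⟨t, x⟩ hq hx v hv
  obtain ⟨w, hw, hg⟩ := exists_chartMetric_eq J hx v
  have hw0 : w ≠ 0 := fun h => hv (hw h)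
  have hn : 0 < ‖w‖ := norm_pos_iff.2 hw0
  -- Positivity holds on the unit sphere, hence everywhere by homogeneity.
  have h3 := hq (‖w‖⁻¹ • w) (by simp [norm_smul, hn.ne'])
  rw [chartMetric_smul_self, chartMetric_smul_self] at h3
  rw [hg, hg]
  by_contra hc
  have : 0 < (‖w‖⁻¹) ^ 2 := by positivity
  nlinarith

/-- On a compact manifold, `Θ₀ + t Θ₁` is taming for small `t` if `Θ₀` is. -/
theorem Tames.eventually [CompactSpace M] {Θ₀ Θ₁ : DiffForm m 2 M} (h₀ : Θ₀.IsCont)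
    (h₁ : Θ₁.IsCont)
    {J : EndField m M} (hJ : IsAlmostComplex J) (ht : Tames Θ₀ J) :
    ∀ᶠ t : ℝ in 𝓝 0, Tames (fun x => Θ₀ x + t • Θ₁ x) J := by
  have h := isCompact_univ.eventually_forall_of_forall_eventually (x₀ := (0 : ℝ)) (K := univ)
    (P := fun t x => ∀ v : TangentSpace (𝓡 m) x, v ≠ 0 →
      0 < metric Θ₀ J x v v + t * metric Θ₁ J x v v)
    fun x _ => Tames.eventually_pos h₀ h₁ hJ ht x
  filter_upwards [h] with t ht
  rw [tames_iff_metric_pos]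
  intro x v hv
  rw [metric_add_smul]
  exact ht x (mem_univ _) v hv

end Metric

/-! ### Potentials with prescribed Hessian at a point -/

section Potential

variable {m : ℕ} {M : Type*} [TopologicalSpace M] [ChartedSpace (Eu m) M]
  [IsManifold (𝓡 m) ∞ M]

/-- At the base point, the differential of the chart is the identity, so that `J` agrees with its
coordinate expression. -/
theorem chartJ_center (J : EndField m M) (x : M) (u : TangentSpace (𝓡 m) x) :
    (chartJ J x (extChartAt (𝓡 m) x x) u : Eu m) = J x u := by
  have h : ∀ (y : M) (hy : y ∈ (extChartAt (𝓡 m) x).source) (u : TangentSpace (𝓡 m) y),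
      (chartJ J x (extChartAt (𝓡 m) x y)
        (mfderiv (𝓡 m) 𝓘(ℝ, Eu m) (extChartAt (𝓡 m) x) y u) : Eu m) =
        mfderiv (𝓡 m) 𝓘(ℝ, Eu m) (extChartAt (𝓡 m) x) y (J y u) := by
    intro y hy u
    obtain ⟨z, hz, rfl⟩ : ∃ z ∈ (extChartAt (𝓡 m) x).target, (extChartAt (𝓡 m) x).symm z = y :=
      ⟨_, (extChartAt (𝓡 m) x).map_source hy, (extChartAt (𝓡 m) x).left_inv hy⟩
    have hu := DFunLike.congr_fun (mfderiv_chart_symm_comp hz) u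
    rw [(extChartAt (𝓡 m) x).right_inv hz]
    exact congrArg (fun u => mfderiv (𝓡 m) 𝓘(ℝ, Eu m) (extChartAt (𝓡 m) x)
      ((extChartAt (𝓡 m) x).symm z) (J ((extChartAt (𝓡 m) x).symm z) u)) hu
  have h1 := h x (mem_extChartAt_source x) u
  rw [mfderiv_extChartAt_self] at h1
  exact h1

theorem hasFDerivAt_comp_sub {E : Type*} [NormedAddCommGroup E] [NormedSpace ℝ E]
    (α : E →L[ℝ] ℝ) (y z : E) : HasFDerivAt (fun z => α (z - y)) α z :=
  (α.hasFDerivAt (x := z - y)).comp z ((hasFDerivAt_id z).sub_const y)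

/-- The exterior derivative at `y` of `-du ∘ A` for the quadratic function `u z = α (z - y)² / 2`.
The derivative of `A` does not contribute, as `du` vanishes at `y`. -/
theorem extDeriv_one_form {E : Type*} [NormedAddCommGroup E] [NormedSpace ℝ E]
    (α : E →L[ℝ] ℝ) {A : E → E →L[ℝ] E} {y : E} (hA : DifferentiableAt ℝ A y) (u v : E) :
    extDeriv (fun z => ContinuousAlternatingMap.ofSubsingleton ℝ E ℝ (0 : Fin 1)
      (-((α (z - y) • α).comp (A z)))) y ![u, v] = α v * α (A y u) - α u * α (A y v) := by
  have hd : DifferentiableAt ℝ (fun z => -((α (z - y) • α).comp (A z))) y := by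
    fun_prop
  have hd2 : DifferentiableAt ℝ (fun z => ContinuousAlternatingMap.ofSubsingleton ℝ E ℝ (0 : Fin 1)
      (-((α (z - y) • α).comp (A z)))) y :=
    (ContinuousAlternatingMap.ofSubsingletonLIE (𝕜 := ℝ) (E := E) (F := ℝ)
      (0 : Fin 1)).toContinuousLinearEquiv.differentiable.differentiableAt.comp y hd
  have hf : ∀ v w : E, fderiv ℝ (fun z => -(α (z - y) * α (A z v))) y w = -(α w * α (A y v)) := by
    intro v w
    have h1 := hasFDerivAt_comp_sub α y y
    have h2 : DifferentiableAt ℝ (fun z => α (A z v)) y := by fun_prop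
    have h3 := (h1.mul h2.hasFDerivAt).neg
    have h4 : fderiv ℝ (fun z => -(α (z - y) * α (A z v))) y = _ := h3.fderiv
    rw [h4]
    simp [mul_comm]
  rw [extDeriv_apply hd2, Fin.sum_univ_two]
  have e0 : (fun z => (ContinuousAlternatingMap.ofSubsingleton ℝ E ℝ (0 : Fin 1)
      (-((α (z - y) • α).comp (A z)))) ((0 : Fin 2).removeNth ![u, v])) =
      fun z => -(α (z - y) * α (A z v)) := rfl
  have e1 : (fun z => (ContinuousAlternatingMap.ofSubsingleton ℝ E ℝ (0 : Fin 1)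
      (-((α (z - y) • α).comp (A z)))) ((1 : Fin 2).removeNth ![u, v])) =
      fun z => -(α (z - y) * α (A z u)) := rfl
  rw [e0, e1, hf, hf]
  simp
  ring

/-- There is a potential `ψ` with `dψ = 0` and Hessian `α ⊗ α` at `x₀`; there `dd^c ψ` is then given
by `α` and `J x₀` alone. -/
theorem exists_potential [T2Space M] {J : EndField m M} (hJ : IsAlmostComplex J) (x₀ : M)
    (α : TangentSpace (𝓡 m) x₀ →L[ℝ] ℝ) :
    ∃ ψ : M → ℝ, ContMDiff (𝓡 m) 𝓘(ℝ, ℝ) ∞ ψ ∧ ∀ u v : TangentSpace (𝓡 m) x₀,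
      (dc J ψ).d x₀ ![u, v] = α v * α (J x₀ u) - α u * α (J x₀ v) := by
  let β : Eu m →L[ℝ] ℝ := α
  set e := extChartAt (𝓡 m) x₀ with he
  have hxt : e x₀ ∈ e.target := mem_extChartAt_target x₀
  have hxs : x₀ ∈ e.source := mem_extChartAt_source x₀
  -- A cut-off of `α² / 2` in the chart at `x₀`.
  let f : SmoothBumpFunction (𝓡 m) x₀ := Classical.arbitrary _
  let ψ : M → ℝ := fun x => f x • ((1 / 2 : ℝ) * β (e x - e x₀) ^ 2)
  have hψ : ContMDiff (𝓡 m) 𝓘(ℝ, ℝ) ∞ ψ := by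
    refine f.contMDiff_smul (g := fun x => (1 / 2 : ℝ) * β (e x - e x₀) ^ 2) ?_
    have h1 : ContDiff ℝ ∞ fun z : Eu m => (1 / 2 : ℝ) * β (z - e x₀) ^ 2 := by fun_prop
    exact h1.contMDiff.comp_contMDiffOn (contMDiffOn_extChartAt (I := 𝓡 m))
  refine ⟨ψ, hψ, fun u v => ?_⟩
  have hu : ∀ᶠ z in 𝓝 (e x₀), ψ (e.symm z) = (1 / 2 : ℝ) * β (z - e x₀) ^ 2 := by
    have h1 : ContinuousAt e.symm (e x₀) := (contMDiffAt_chart_symm hxt).continuousAt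
    have h2 : ∀ᶠ x in 𝓝 (e.symm (e x₀)), f x = 1 := by
      rw [e.left_inv hxs]; exact f.eventuallyEq_one
    filter_upwards [h1.eventually h2, (isOpen_chart_target x₀).mem_nhds hxt] with z hz hzt
    simp only [ψ, hz, e.right_inv hzt, one_smul]
  have hfd : ∀ᶠ z in 𝓝 (e x₀), fderiv ℝ (fun z => ψ (e.symm z)) z = β (z - e x₀) • β := by
    filter_upwards [eventually_eventually_nhds.2 hu] with z hz
    have h1 := hasFDerivAt_comp_sub β (e x₀) z
    have h2 := (h1.pow 2).const_mul (1 / 2 : ℝ)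
    rw [Filter.EventuallyEq.fderiv_eq hz, h2.fderiv]
    ext w
    simp
    ring
  have hev : (dc J ψ).inChart x₀ =ᶠ[𝓝 (e x₀)] fun z =>
      ContinuousAlternatingMap.ofSubsingleton ℝ (Eu m) ℝ (0 : Fin 1)
        (-((β (z - e x₀) • β).comp (chartJ J x₀ z))) := by
    filter_upwards [hfd, (isOpen_chart_target x₀).mem_nhds hxt] with z hz hzt
    rw [dc_inChart J hψ hzt, hz]
  have hA : DifferentiableAt ℝ (chartJ J x₀) (e x₀) :=
    ((contDiffOn_chartJ hJ x₀).contDiffAt ((isOpen_chart_target x₀).mem_nhds hxt)).differentiableAt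
      (by simp)
  have key := extDeriv_one_form β hA u v
  rw [← hev.extDeriv_eq, chartJ_center, chartJ_center] at key
  rw [DiffForm.d, mfderiv_extChartAt_self]
  exact key

end Potential

/-! ### Integrals of square roots of quadratic polynomials -/

section Parametric

variable {E : Type*} [TopologicalSpace E] [MeasurableSpace E] [OpensMeasurableSpace E]
  [T2Space E] {μ : Measure E} [IsFiniteMeasureOnCompacts μ]

/-- Differentiation under an integral over a compact set. -/
theorem hasDerivAt_setIntegral_of_isCompact {K : Set E} (hK : IsCompact K) {f f' : ℝ → E → ℝ}
    {δ : ℝ} (hf : ∀ t ∈ Icc (-δ) δ, ContinuousOn (f t) K)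
    (hf' : ContinuousOn (fun q : ℝ × E => f' q.1 q.2) (Icc (-δ) δ ×ˢ K))
    (hd : ∀ t ∈ Ioo (-δ) δ, ∀ y ∈ K, HasDerivAt (fun t => f t y) (f' t y) t) {t₀ : ℝ}
    (ht₀ : t₀ ∈ Ioo (-δ) δ) :
    HasDerivAt (fun t => ∫ y in K, f t y ∂μ) (∫ y in K, f' t₀ y ∂μ) t₀ := by
  obtain ⟨C, hC⟩ := (isCompact_Icc.prod hK).exists_bound_of_continuousOn hf'
  have hmem : Ioo (-δ) δ ∈ 𝓝 t₀ := Ioo_mem_nhds ht₀.1 ht₀.2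
  have hint : ∀ t ∈ Icc (-δ) δ, IntegrableOn (f t) K μ := fun t ht =>
    (hf t ht).integrableOn_compact hK
  refine (hasDerivAt_integral_of_dominated_loc_of_deriv_le (bound := fun _ => C) hmem ?_
    (hint t₀ (Ioo_subset_Icc_self ht₀)) ?_ ?_ ?_ ?_).2
  · filter_upwards [hmem] with t ht
    exact (hint t (Ioo_subset_Icc_self ht)).aestronglyMeasurable
  · have : ContinuousOn (f' t₀) K := hf'.comp (f := fun y => (t₀, y)) (by fun_prop)
      fun y hy => ⟨Ioo_subset_Icc_self ht₀, hy⟩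
    exact (this.integrableOn_compact hK).aestronglyMeasurable
  · refine (ae_restrict_iff' hK.measurableSet).2 (Eventually.of_forall fun y hy t ht => ?_)
    exact hC (t, y) ⟨Ioo_subset_Icc_self ht, hy⟩
  · exact integrableOn_const hK.measure_ne_top
  · exact (ae_restrict_iff' hK.measurableSet).2 (Eventually.of_forall fun y hy t ht => hd t ht y hy)

theorem hasDerivAt_sqrt_quadratic {a b c t : ℝ} (h : 0 < a + b * t + c * t ^ 2) :
    HasDerivAt (fun t => √(a + b * t + c * t ^ 2))
      ((b + 2 * c * t) / (2 * √(a + b * t + c * t ^ 2))) t := by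
  have h1 : HasDerivAt (fun t => a + b * t + c * t ^ 2) (b + 2 * c * t) t := by
    have := (((hasDerivAt_id t).const_mul b).const_add a).add
      (((hasDerivAt_id t).pow 2).const_mul c)
    convert! this using 1
    simp; ring
  exact h1.sqrt h.ne'

theorem hasDerivAt_deriv_sqrt_quadratic {a b c t : ℝ} (h : 0 < a + b * t + c * t ^ 2) :
    HasDerivAt (fun t => (b + 2 * c * t) / (2 * √(a + b * t + c * t ^ 2)))
      ((4 * c * (a + b * t + c * t ^ 2) - (b + 2 * c * t) ^ 2) /
        (4 * (a + b * t + c * t ^ 2) * √(a + b * t + c * t ^ 2))) t := by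
  have h1 : HasDerivAt (fun t => b + 2 * c * t) (2 * c) t := by
    simpa using ((hasDerivAt_id t).const_mul (2 * c)).const_add b
  have hs : 0 < √(a + b * t + c * t ^ 2) := Real.sqrt_pos.2 h
  have h2 := h1.div ((hasDerivAt_sqrt_quadratic h).const_mul 2) (by positivity)
  convert! h2 using 1
  have hq := Real.sq_sqrt h.le
  generalize √(a + b * t + c * t ^ 2) = s at *
  rw [← hq]
  field_simp
  rw [hq]
  ring

/-- The second derivative of a weighted integral of square roots of quadratic polynomials. -/
theorem exists_second_deriv_integral_sqrt {K U : Set E} (hK : IsCompact K) (hU : IsOpen U)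
    (hKU : K ⊆ U) {χ a b c : E → ℝ} (hχ : ContinuousOn χ U) (ha : ContinuousOn a U)
    (hb : ContinuousOn b U) (hc : ContinuousOn c U) (hpos : ∀ y ∈ K, 0 < a y) :
    ∃ A' : ℝ → ℝ, (∀ᶠ t in 𝓝 (0 : ℝ), HasDerivAt
      (fun t => ∫ y in K, χ y * √(a y + b y * t + c y * t ^ 2) ∂μ) (A' t) t) ∧
      HasDerivAt A' (∫ y in K, χ y * ((4 * c y * a y - b y ^ 2) / (4 * a y * √(a y))) ∂μ) 0 := by
  have hev : ∀ᶠ t in 𝓝 (0 : ℝ), ∀ y ∈ K, 0 < a y + b y * t + c y * t ^ 2 := by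
    refine hK.eventually_forall_of_forall_eventually fun y hy => ?_
    have hn := hU.mem_nhds (hKU hy)
    have hc1 : ContinuousAt (fun z : ℝ × E => a z.2 + b z.2 * z.1 + c z.2 * z.1 ^ 2) (0, y) := by
      have h1 : ContinuousAt (fun z : ℝ × E => a z.2) (0, y) :=
        (ha.continuousAt hn).comp continuousAt_snd
      have h2 : ContinuousAt (fun z : ℝ × E => b z.2) (0, y) :=
        (hb.continuousAt hn).comp continuousAt_snd
      have h3 : ContinuousAt (fun z : ℝ × E => c z.2) (0, y) :=
        (hc.continuousAt hn).comp continuousAt_snd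
      exact (h1.add (h2.mul continuousAt_fst)).add (h3.mul (continuousAt_fst.pow 2))
    refine hc1.eventually (lt_mem_nhds ?_)
    simpa using hpos y hy
  obtain ⟨δ₀, hδ₀, hball⟩ := Metric.eventually_nhds_iff.1 hev
  -- The closed interval of radius `δ₀ / 2` lies in the open one of radius `δ₀`.
  set δ := δ₀ / 2 with hδ
  have hδp : 0 < δ := by positivity
  have hD : ∀ t ∈ Icc (-δ) δ, ∀ y ∈ K, 0 < a y + b y * t + c y * t ^ 2 := fun t ht =>
    hball (by rw [Real.dist_eq, sub_zero]; exact (abs_le.2 ht).trans_lt (by linarith))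
  have hχ' : ContinuousOn (fun q : ℝ × E => χ q.2) (Icc (-δ) δ ×ˢ K) :=
    (hχ.mono hKU).comp continuousOn_snd fun q hq => hq.2
  have ha' : ContinuousOn (fun q : ℝ × E => a q.2) (Icc (-δ) δ ×ˢ K) :=
    (ha.mono hKU).comp continuousOn_snd fun q hq => hq.2
  have hb' : ContinuousOn (fun q : ℝ × E => b q.2) (Icc (-δ) δ ×ˢ K) :=
    (hb.mono hKU).comp continuousOn_snd fun q hq => hq.2
  have hc' : ContinuousOn (fun q : ℝ × E => c q.2) (Icc (-δ) δ ×ˢ K) :=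
    (hc.mono hKU).comp continuousOn_snd fun q hq => hq.2
  have hD' : ContinuousOn (fun q : ℝ × E => a q.2 + b q.2 * q.1 + c q.2 * q.1 ^ 2)
      (Icc (-δ) δ ×ˢ K) :=
    (ha'.add (hb'.mul continuousOn_fst)).add (hc'.mul (continuousOn_fst.pow 2))
  have hN' : ContinuousOn (fun q : ℝ × E => b q.2 + 2 * c q.2 * q.1) (Icc (-δ) δ ×ˢ K) :=
    hb'.add ((continuousOn_const.mul hc').mul continuousOn_fst)
  have hs' := hD'.sqrt
  have hslice : ∀ {g : ℝ × E → ℝ}, ContinuousOn g (Icc (-δ) δ ×ˢ K) → ∀ t ∈ Icc (-δ) δ,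
      ContinuousOn (fun y => g (t, y)) K := fun hg t ht =>
    hg.comp (f := fun y => (t, y)) (by fun_prop) fun y hy => ⟨ht, hy⟩
  have hf₀ : ContinuousOn (fun q : ℝ × E => χ q.2 * √(a q.2 + b q.2 * q.1 + c q.2 * q.1 ^ 2))
      (Icc (-δ) δ ×ˢ K) := hχ'.mul hs'
  have hf₁ : ContinuousOn (fun q : ℝ × E => χ q.2 * ((b q.2 + 2 * c q.2 * q.1) /
      (2 * √(a q.2 + b q.2 * q.1 + c q.2 * q.1 ^ 2)))) (Icc (-δ) δ ×ˢ K) := by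
    refine hχ'.mul (hN'.div (continuousOn_const.mul hs') fun q hq => ?_)
    have := Real.sqrt_pos.2 (hD q.1 hq.1 q.2 hq.2)
    positivity
  have hf₂ : ContinuousOn (fun q : ℝ × E => χ q.2 *
      ((4 * c q.2 * (a q.2 + b q.2 * q.1 + c q.2 * q.1 ^ 2) - (b q.2 + 2 * c q.2 * q.1) ^ 2) /
        (4 * (a q.2 + b q.2 * q.1 + c q.2 * q.1 ^ 2) *
          √(a q.2 + b q.2 * q.1 + c q.2 * q.1 ^ 2)))) (Icc (-δ) δ ×ˢ K) := by
    refine hχ'.mul ((((continuousOn_const.mul hc').mul hD').sub (hN'.pow 2)).div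
      ((continuousOn_const.mul hD').mul hs') fun q hq => ?_)
    have h1 := hD q.1 hq.1 q.2 hq.2
    have h2 := Real.sqrt_pos.2 h1
    positivity
  refine ⟨fun t => ∫ y in K, χ y * ((b y + 2 * c y * t) /
      (2 * √(a y + b y * t + c y * t ^ 2))) ∂μ, ?_, ?_⟩
  · filter_upwards [Ioo_mem_nhds (neg_lt_zero.2 hδp) hδp] with t ht
    exact hasDerivAt_setIntegral_of_isCompact hK (hslice hf₀) hf₁
      (fun t ht y hy => (hasDerivAt_sqrt_quadratic
        (hD t (Ioo_subset_Icc_self ht) y hy)).const_mul (χ y)) ht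
  · have h := hasDerivAt_setIntegral_of_isCompact (μ := μ) hK (hslice hf₁) hf₂
      (fun t ht y hy => (hasDerivAt_deriv_sqrt_quadratic
        (hD t (Ioo_subset_Icc_self ht) y hy)).const_mul (χ y)) (t₀ := 0)
        ⟨neg_lt_zero.2 hδp, hδp⟩
    simpa using h

theorem setIntegral_neg_of_continuousOn [μ.IsOpenPosMeasure] {K U : Set E} (hK : IsCompact K)
    (hU : IsOpen U) (hKU : K ⊆ U) {f : E → ℝ} (hf : ContinuousOn f U) (hn : ∀ y ∈ U, f y ≤ 0)
    (hoff : ∀ y ∈ U \ K, f y = 0) {y₀ : E} (hy₀ : y₀ ∈ U) (hneg : f y₀ < 0) :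
    ∫ y in K, f y ∂μ < 0 := by
  have h1 : 0 < ∫ y in K, -f y ∂μ := by
    rw [setIntegral_pos_iff_support_of_nonneg_ae]
    · have hV : IsOpen (U ∩ f ⁻¹' Iio 0) := hf.isOpen_inter_preimage hU isOpen_Iio
      refine (hV.measure_pos μ ⟨y₀, hy₀, hneg⟩).trans_le (measure_mono ?_)
      rintro y ⟨hyU, hy⟩
      refine ⟨by simpa using (ne_of_lt hy), ?_⟩
      by_contra hyK
      exact (ne_of_lt hy) (hoff y ⟨hyU, hyK⟩)
    · exact (ae_restrict_iff' hK.measurableSet).2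
        (Eventually.of_forall fun y hy => neg_nonneg.2 (hn y (hKU hy)))
    · exact ((hf.mono hKU).neg.integrableOn_compact hK)
  rw [integral_neg] at h1
  linarith

end Parametric

/-- The discriminant inequality behind the concavity of the area density: for a definite symmetric
form `g` and a symmetric form `h` in two variables, the discriminant of the quadratic polynomial
`det (g + t h)` in `t` is nonnegative. -/
theorem discriminant_nonneg {g₀ g₁ g₂ h₀ h₁ h₂ : ℝ} (hg : 0 < g₀ * g₂ - g₁ ^ 2) :
    4 * (h₀ * h₂ - h₁ ^ 2) * (g₀ * g₂ - g₁ ^ 2) - (g₀ * h₂ + g₂ * h₀ - 2 * g₁ * h₁) ^ 2 ≤ 0 := by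
  have h0 : g₀ ≠ 0 := by rintro rfl; nlinarith [sq_nonneg g₁]
  -- `g₀ ^ 2` times the discriminant, as a sum of nonnegative terms.
  have key : g₀ ^ 2 * (4 * (h₀ * h₂ - h₁ ^ 2) * (g₀ * g₂ - g₁ ^ 2) -
      (g₀ * h₂ + g₂ * h₀ - 2 * g₁ * h₁) ^ 2) =
      -((g₀ ^ 2 * h₂ - 2 * g₀ * g₁ * h₁ + 2 * g₁ ^ 2 * h₀ - g₀ * g₂ * h₀) ^ 2 +
        4 * (g₀ * g₂ - g₁ ^ 2) * (g₀ * h₁ - g₁ * h₀) ^ 2) := by ring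
  have h1 : 0 < g₀ ^ 2 := by positivity
  by_contra hc
  push Not at hc
  have h2 := mul_pos h1 hc
  rw [key] at h2
  have h3 := mul_nonneg hg.le (sq_nonneg (g₀ * h₁ - g₁ * h₀))
  nlinarith [sq_nonneg (g₀ ^ 2 * h₂ - 2 * g₀ * g₁ * h₁ + 2 * g₁ ^ 2 * h₀ - g₀ * g₂ * h₀)]

/-! ### The area along an affine family of forms -/

section Surface

variable {m : ℕ} {M : Type*} [TopologicalSpace M] [ChartedSpace (Eu m) M]
  {S : Type*} [TopologicalSpace S] [ChartedSpace (Eu 2) S]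

/-- The map `F` in the chart of the surface at `p`. -/
def surfaceMap (F : S → M) (p : S) (y : Eu 2) : M := F ((extChartAt (𝓡 2) p).symm y)

/-- The coordinate tangent vector `∂F/∂xᵢ` in the chart of the surface at `p`. -/
def surfaceVec (m : ℕ) {M : Type*} [TopologicalSpace M] [ChartedSpace (Eu m) M]
    (F : S → M) (p : S) (y : Eu 2) (i : Fin 2) : Eu m :=
  modelMFDeriv (m := m) (surfaceMap F p) y (EuclideanSpace.single i (1 : ℝ))

theorem gramCoeff_eq (g : ∀ x : M, TangentSpace (𝓡 m) x → TangentSpace (𝓡 m) x → ℝ)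
    (F : S → M) (p : S) (y : Eu 2) (i j : Fin 2) :
    gramCoeff g F p y i j = g (surfaceMap F p y) (surfaceVec m F p y i) (surfaceVec m F p y j) :=
  rfl

theorem gramCoeff_comm (Θ : DiffForm m 2 M) (J : EndField m M)
    (F : S → M) (p : S) (y : Eu 2) (i j : Fin 2) :
    gramCoeff (metric Θ J) F p y i j = gramCoeff (metric Θ J) F p y j i :=
  metric_symm Θ J _ _ _

/-- The determinant of the Gram matrix of `F^* (metric Θ J)` in the chart of the surface at `p`; the
Gram matrix is symmetric, so its off-diagonal entries are both taken to be the `(0, 1)` entry. -/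
def gramDet (Θ : DiffForm m 2 M) (J : EndField m M) (F : S → M) (p : S) (y : Eu 2) : ℝ :=
  gramCoeff (metric Θ J) F p y 0 0 * gramCoeff (metric Θ J) F p y 1 1 -
    gramCoeff (metric Θ J) F p y 0 1 ^ 2

/-- The polarization of `gramDet`: the coefficient of `t` in the Gram determinant of
`Θ₀ + t Θ₁`. -/
def gramMixed (Θ₀ Θ₁ : DiffForm m 2 M) (J : EndField m M) (F : S → M) (p : S) (y : Eu 2) : ℝ :=
  gramCoeff (metric Θ₀ J) F p y 0 0 * gramCoeff (metric Θ₁ J) F p y 1 1 +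
    gramCoeff (metric Θ₀ J) F p y 1 1 * gramCoeff (metric Θ₁ J) F p y 0 0 -
    2 * gramCoeff (metric Θ₀ J) F p y 0 1 * gramCoeff (metric Θ₁ J) F p y 0 1

/-- Along an affine family of forms, the area density is the square root of a quadratic polynomial
in `t`. -/
theorem areaDensity_add_smul (Θ₀ Θ₁ : DiffForm m 2 M) (J : EndField m M)
    (F : S → M) (p : S) (y : Eu 2) (t : ℝ) :
    areaDensity (metric (fun x => Θ₀ x + t • Θ₁ x) J) F p y =
      √(gramDet Θ₀ J F p y + gramMixed Θ₀ Θ₁ J F p y * t + gramDet Θ₁ J F p y * t ^ 2) := by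
  have h : ∀ i j, gramCoeff (metric (fun x => Θ₀ x + t • Θ₁ x) J) F p y i j =
      gramCoeff (metric Θ₀ J) F p y i j + t * gramCoeff (metric Θ₁ J) F p y i j :=
    fun i j => metric_add_smul Θ₀ Θ₁ J t _ _ _
  rw [areaDensity, Matrix.det_fin_two]
  simp only [Matrix.of_apply]
  rw [gramCoeff_comm _ J F p y 1 0]
  simp only [h, gramDet, gramMixed]
  congr 1
  ring

theorem surfaceVec_lin (F : S → M) (p : S) (y w : Eu 2) :
    (modelMFDeriv (surfaceMap F p) y w : Eu m) =
      w 0 • surfaceVec m F p y 0 + w 1 • surfaceVec m F p y 1 := by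
  have hw : w = w 0 • EuclideanSpace.single 0 (1 : ℝ) + w 1 • EuclideanSpace.single 1 (1 : ℝ) := by
    ext i; fin_cases i <;> simp
  conv_lhs => rw [hw]
  rw [map_add, map_smul, map_smul]
  rfl

variable [IsManifold (𝓡 2) ∞ S]

theorem contMDiffAt_surfaceMap {F : S → M} (hF : ContMDiff (𝓡 2) (𝓡 m) ∞ F) {p : S} {y : Eu 2}
    (hy : y ∈ (extChartAt (𝓡 2) p).target) :
    ContMDiffAt 𝓘(ℝ, Eu 2) (𝓡 m) ∞ (surfaceMap F p) y :=
  (hF _).comp y (contMDiffAt_chart_symm hy)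

theorem modelMFDeriv_surfaceMap {F : S → M} (hF : ContMDiff (𝓡 2) (𝓡 m) ∞ F) {p : S} {y : Eu 2}
    (hy : y ∈ (extChartAt (𝓡 2) p).target) (w : Eu 2) :
    (modelMFDeriv (surfaceMap F p) y w : Eu m) =
      mfderiv (𝓡 2) (𝓡 m) F ((extChartAt (𝓡 2) p).symm y)
        (modelMFDeriv (m := 2) (extChartAt (𝓡 2) p).symm y w) :=
  DFunLike.congr_fun (mfderiv_comp y (hF.mdifferentiable (by simp) _)
    (mdifferentiableAt_chart_symm hy)) w

/-- As `F` is an immersion, the coordinate tangent vectors are linearly independent. -/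
theorem surfaceVec_independent {F : S → M} (hF : IsImmersion (m := m) F) {p : S} {y : Eu 2}
    (hy : y ∈ (extChartAt (𝓡 2) p).target) (a b : ℝ)
    (h : a • surfaceVec m F p y 0 + b • surfaceVec m F p y 1 = 0) : a = 0 ∧ b = 0 := by
  have h1 := surfaceVec_lin (m := m) F p y !₂[a, b]
  have h2 : (modelMFDeriv (surfaceMap F p) y !₂[a, b] : Eu m) = 0 := h1.trans h
  rw [modelMFDeriv_surfaceMap hF.1 hy] at h2
  have h3 : (modelMFDeriv (m := 2) (extChartAt (𝓡 2) p).symm y !₂[a, b] : Eu 2) = 0 :=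
    hF.2 _ (h2.trans (map_zero _).symm)
  have h4 : !₂[a, b] = (0 : Eu 2) := eq_zero_of_modelMFDeriv_chart_symm hy h3
  exact ⟨by simpa using congrArg (fun v : Eu 2 => v 0) h4,
    by simpa using congrArg (fun v : Eu 2 => v 1) h4⟩

theorem gram_det_pos {Θ : DiffForm m 2 M} {J : EndField m M} (hΘ : Tames Θ J) {F : S → M}
    (hF : IsImmersion (m := m) F) {p : S} {y : Eu 2} (hy : y ∈ (extChartAt (𝓡 2) p).target) :
    0 < gramDet Θ J F p y :=
  hΘ.gram_pos (u := surfaceVec m F p y 0) (v := surfaceVec m F p y 1)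
    (surfaceVec_independent hF hy)

variable [IsManifold (𝓡 m) ∞ M]

theorem continuousOn_gramCoeff {Θ : DiffForm m 2 M} (hΘ : Θ.IsCont) {J : EndField m M}
    (hJ : IsAlmostComplex J) {F : S → M} (hF : ContMDiff (𝓡 2) (𝓡 m) ∞ F) (p : S) (i j : Fin 2) :
    ContinuousOn (fun y => gramCoeff (metric Θ J) F p y i j) (extChartAt (𝓡 2) p).target := by
  intro y₀ hy₀
  refine ContinuousAt.continuousWithinAt ?_
  set x₀ := surfaceMap F p y₀ with hx₀
  have hG := contMDiffAt_surfaceMap hF hy₀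
  have hxs : x₀ ∈ (extChartAt (𝓡 m) x₀).source := mem_extChartAt_source x₀
  have hf : ContDiffAt ℝ ∞ (fun y => extChartAt (𝓡 m) x₀ (surfaceMap F p y)) y₀ :=
    ((contMDiffAt_extChartAt (I := 𝓡 m) (n := ∞) (x := x₀)).comp y₀ hG).contDiffAt
  have hD : ContinuousAt (fderiv ℝ (fun y => extChartAt (𝓡 m) x₀ (surfaceMap F p y))) y₀ :=
    (hf.fderiv_right (m := 0) (by simp)).continuousAt
  have hc := continuousAt_chartMetric hΘ hJ x₀ hf.continuousAt
    (hD.clm_apply (continuousAt_const (y := EuclideanSpace.single i (1 : ℝ))))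
    (hD.clm_apply (continuousAt_const (y := EuclideanSpace.single j (1 : ℝ))))
    (mem_extChartAt_target x₀)
  refine hc.congr ?_
  filter_upwards [(isOpen_chart_target p).mem_nhds hy₀,
    hG.continuousAt.preimage_mem_nhds ((isOpen_extChartAt_source x₀).mem_nhds hxs)] with y hy hys
  exact (metric_modelMFDeriv Θ J ((contMDiffAt_surfaceMap hF hy).mdifferentiableAt (by simp)) hys
    _ _).symm

variable [T2Space S] [CompactSpace S]

/-- The contribution of one chart to the area is twice differentiable along an affine family of
forms, and its second derivative is nonpositive; it is negative if the discriminant of the Gram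
determinant is positive at a point where the cut-off function is positive. -/
theorem exists_second_deriv_chart_area {Θ₀ Θ₁ : DiffForm m 2 M} (h₀ : Θ₀.IsCont) (h₁ : Θ₁.IsCont)
    {J : EndField m M} (hJ : IsAlmostComplex J) (ht : Tames Θ₀ J) {F : S → M}
    (hF : IsImmersion (m := m) F) (p : S) :
    ∃ (A' : ℝ → ℝ) (I : ℝ), (∀ᶠ t in 𝓝 (0 : ℝ), HasDerivAt
      (fun t => ∫ y in (extChartAt (𝓡 2) p).target,
        chartPartition S p ((extChartAt (𝓡 2) p).symm y) *
          areaDensity (metric (fun x => Θ₀ x + t • Θ₁ x) J) F p y) (A' t) t) ∧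
      HasDerivAt A' I 0 ∧ I ≤ 0 ∧
      ((∃ y ∈ (extChartAt (𝓡 2) p).target,
        0 < chartPartition S p ((extChartAt (𝓡 2) p).symm y) ∧
        4 * gramDet Θ₁ J F p y * gramDet Θ₀ J F p y - gramMixed Θ₀ Θ₁ J F p y ^ 2 < 0) →
        I < 0) := by
  set e := extChartAt (𝓡 2) p with he
  set K : Set (Eu 2) := e '' tsupport (chartPartition S p) with hK
  have hsub : tsupport (chartPartition S p) ⊆ e.source := by
    simpa [he] using chartPartition_isSubordinate S p
  have hKc : IsCompact K := (isClosed_tsupport _).isCompact.image_of_continuousOn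
    ((continuousOn_extChartAt (I := 𝓡 2) p).mono hsub)
  have hKU : K ⊆ e.target := by
    rintro _ ⟨q, hq, rfl⟩; exact e.map_source (hsub hq)
  have hU : IsOpen e.target := isOpen_chart_target p
  -- The chart integral only sees the compact set `K`, on which the densities are controlled.
  have hoff : ∀ y ∈ e.target \ K, chartPartition S p (e.symm y) = 0 := by
    rintro y ⟨hy, hyK⟩
    by_contra hne
    exact hyK ⟨e.symm y, subset_tsupport _ hne, e.right_inv hy⟩
  set χ : Eu 2 → ℝ := fun y => chartPartition S p (e.symm y) with hχ
  have hχc : ContinuousOn χ e.target :=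
    (chartPartition S p).contMDiff.continuous.comp_continuousOn
      (continuousOn_extChartAt_symm (I := 𝓡 2) p)
  have hg := fun i j => continuousOn_gramCoeff h₀ hJ hF.1 p i j
  have hh := fun i j => continuousOn_gramCoeff h₁ hJ hF.1 p i j
  have hapos : ∀ y ∈ e.target, 0 < gramDet Θ₀ J F p y := fun y hy => gram_det_pos ht hF hy
  have hac : ContinuousOn (gramDet Θ₀ J F p) e.target :=
    ((hg 0 0).mul (hg 1 1)).sub ((hg 0 1).pow 2)
  have hbc : ContinuousOn (gramMixed Θ₀ Θ₁ J F p) e.target :=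
    (((hg 0 0).mul (hh 1 1)).add ((hg 1 1).mul (hh 0 0))).sub
      ((continuousOn_const (c := (2 : ℝ)).mul (hg 0 1)).mul (hh 0 1))
  have hcc : ContinuousOn (gramDet Θ₁ J F p) e.target :=
    ((hh 0 0).mul (hh 1 1)).sub ((hh 0 1).pow 2)
  have hdisc : ∀ y ∈ e.target,
      4 * gramDet Θ₁ J F p y * gramDet Θ₀ J F p y - gramMixed Θ₀ Θ₁ J F p y ^ 2 ≤ 0 :=
    fun y hy => discriminant_nonneg (hapos y hy)
  have hden : ∀ y ∈ e.target, 0 < 4 * gramDet Θ₀ J F p y * √(gramDet Θ₀ J F p y) := fun y hy => by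
    have h1 := hapos y hy
    have h2 := Real.sqrt_pos.2 h1
    positivity
  have hle : ∀ y ∈ e.target, χ y * ((4 * gramDet Θ₁ J F p y * gramDet Θ₀ J F p y -
      gramMixed Θ₀ Θ₁ J F p y ^ 2) / (4 * gramDet Θ₀ J F p y * √(gramDet Θ₀ J F p y))) ≤ 0 :=
    fun y hy => mul_nonpos_of_nonneg_of_nonpos ((chartPartition S).nonneg p _)
      (div_nonpos_of_nonpos_of_nonneg (hdisc y hy) (hden y hy).le)
  obtain ⟨A', hA, hA'⟩ := exists_second_deriv_integral_sqrt (μ := volume) hKc hU hKU hχc hac hbc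
    hcc fun y hy => hapos y (hKU hy)
  have hint : ∀ t : ℝ, ∫ y in e.target, chartPartition S p (e.symm y) *
      areaDensity (metric (fun x => Θ₀ x + t • Θ₁ x) J) F p y = ∫ y in K, _ := fun t =>
    setIntegral_eq_of_subset_of_forall_sdiff_eq_zero hU.measurableSet hKU fun y hy => by
      rw [hoff y hy, zero_mul]
  simp only [areaDensity_add_smul] at hint
  simp only [areaDensity_add_smul, hint]
  refine ⟨A', _, hA, hA', ?_, ?_⟩
  · exact setIntegral_nonpos hKc.measurableSet fun y hy => hle y (hKU hy)
  · rintro ⟨y, hy, hχy, hneg⟩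
    refine setIntegral_neg_of_continuousOn hKc hU hKU ?_ hle (fun z hz => ?_) hy
      (mul_neg_of_pos_of_neg hχy (div_neg_of_neg_of_pos hneg (hden y hy)))
    · exact hχc.mul ((((continuousOn_const.mul hcc).mul hac).sub (hbc.pow 2)).div
        ((continuousOn_const.mul hac).mul hac.sqrt) fun z hz => (hden z hz).ne')
    · rw [show χ z = 0 from hoff z hz, zero_mul]

/-- Along an affine family of forms, the second derivative of the area is negative as soon as the
discriminant of the Gram determinant is positive at one point. -/
theorem second_deriv_area_neg {Θ₀ Θ₁ : DiffForm m 2 M} (h₀ : Θ₀.IsCont) (h₁ : Θ₁.IsCont)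
    {J : EndField m M} (hJ : IsAlmostComplex J) (ht : Tames Θ₀ J) {F : S → M}
    (hF : IsImmersion (m := m) F) (p : S) {y : Eu 2} (hy : y ∈ (extChartAt (𝓡 2) p).target)
    (hχ : 0 < chartPartition S p ((extChartAt (𝓡 2) p).symm y))
    (hneg : 4 * gramDet Θ₁ J F p y * gramDet Θ₀ J F p y - gramMixed Θ₀ Θ₁ J F p y ^ 2 < 0) :
    iteratedDeriv 2 (fun t : ℝ => areaOf (metric (fun x => Θ₀ x + t • Θ₁ x) J) F) 0 < 0 := by
  choose A' I hA hA' hI hI' using fun p => exists_second_deriv_chart_area h₀ h₁ hJ ht hF p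
  -- Only finitely many of the cut-off functions are nonzero.
  have hfin : {p | (Function.support (chartPartition S p)).Nonempty}.Finite :=
    (chartPartition S).locallyFinite.finite_nonempty_of_compact
  have hsum : ∀ t : ℝ, areaOf (metric (fun x => Θ₀ x + t • Θ₁ x) J) F =
      ∑ p ∈ hfin.toFinset, ∫ y in (extChartAt (𝓡 2) p).target,
        chartPartition S p ((extChartAt (𝓡 2) p).symm y) *
          areaDensity (metric (fun x => Θ₀ x + t • Θ₁ x) J) F p y := by
    intro t
    refine finsum_eq_sum_of_support_subset _ fun p hp => ?_
    rw [Finite.coe_toFinset]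
    by_contra hne
    rw [mem_ofPred_eq, not_nonempty_iff_eq_empty, Function.support_eq_empty_iff] at hne
    exact hp (by simp [hne])
  have hd1 : ∀ᶠ t in 𝓝 (0 : ℝ), HasDerivAt
      (fun t : ℝ => areaOf (metric (fun x => Θ₀ x + t • Θ₁ x) J) F)
      (∑ p ∈ hfin.toFinset, A' p t) t := by
    simp only [hsum]
    filter_upwards [(eventually_all_finset hfin.toFinset).2 fun p _ => hA p] with t ht
    exact HasDerivAt.fun_sum ht
  have hd2 : HasDerivAt (fun t => ∑ p ∈ hfin.toFinset, A' p t) (∑ p ∈ hfin.toFinset, I p) 0 :=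
    HasDerivAt.fun_sum fun p _ => hA' p
  have hev : deriv (fun t : ℝ => areaOf (metric (fun x => Θ₀ x + t • Θ₁ x) J) F) =ᶠ[𝓝 0]
      fun t => ∑ p ∈ hfin.toFinset, A' p t := hd1.mono fun t ht => ht.deriv
  rw [iteratedDeriv_succ, iteratedDeriv_one, hev.deriv_eq, hd2.deriv]
  exact Finset.sum_neg' (fun p _ => hI p) ⟨p, hfin.mem_toFinset.2 ⟨_, hχ.ne'⟩,
    hI' p ⟨y, hy, hχ, hneg⟩⟩

end Surface

/-! ### Destabilizing variations -/

section Holomorphic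

variable {m : ℕ} {M : Type*} [TopologicalSpace M] [ChartedSpace (Eu m) M]
  [IsManifold (𝓡 m) ∞ M]
  {S : Type*} [TopologicalSpace S] [ChartedSpace (Eu 2) S]

/-- The affine path `ρ + t ψ` stays in `ℋ` for small `t`. -/
theorem exists_isVariation [CompactSpace M] {Ω : DiffForm m 2 M} (hΩ : Ω.IsSmooth)
    {J : EndField m M} (hJ : IsAlmostComplex J) {ρ ψ : M → ℝ} (hρ : ρ ∈ Potentials Ω J)
    (hψ : ContMDiff (𝓡 m) 𝓘(ℝ, ℝ) ∞ ψ) :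
    ∃ ε, IsVariation Ω J ρ ε (fun t x => ρ x + t * ψ x) := by
  have hev := Tames.eventually (deform_isCont hΩ hJ hρ.1) (dc_isSmooth hJ hψ).d_isCont hJ hρ.2
  obtain ⟨ε, hε, hball⟩ := Metric.eventually_nhds_iff.1 hev
  refine ⟨ε, hε, ?_, fun t ht => ⟨?_, ?_⟩, ?_⟩
  · refine ContMDiff.contMDiffOn ?_
    exact (hρ.1.comp contMDiff_snd).add (contMDiff_fst.mul (hψ.comp contMDiff_snd))
  · exact hρ.1.add (contMDiff_const.mul hψ)
  · rw [show deform Ω J (fun x => ρ x + t * ψ x) = _ from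
      funext (deform_add_smul Ω hJ hρ.1 hψ t)]
    exact hball (by rw [Real.dist_eq, sub_zero]; exact abs_lt.2 ht)
  · funext x; simp

/-- If a tangent plane of the surface is not `J`-invariant, then some tangent vector `v` at that
point has `J v` outside the plane, and a linear functional vanishes on the plane but not
at `J v`. -/
theorem exists_functional {J : EndField m M} (hJ : IsAlmostComplex J) {F : S → M} {q : S}
    (hq : (LinearMap.range (mfderiv (𝓡 2) (𝓡 m) F q).toLinearMap).map (J (F q)).toLinearMap
      ≠ LinearMap.range (mfderiv (𝓡 2) (𝓡 m) F q).toLinearMap) :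
    ∃ α : TangentSpace (𝓡 m) (F q) →L[ℝ] ℝ, (∀ w, α (mfderiv (𝓡 2) (𝓡 m) F q w) = 0) ∧
      ∃ w, α (J (F q) (mfderiv (𝓡 2) (𝓡 m) F q w)) ≠ 0 := by
  set P := LinearMap.range (mfderiv (𝓡 2) (𝓡 m) F q).toLinearMap with hP
  obtain ⟨w, hw⟩ : ∃ w, J (F q) (mfderiv (𝓡 2) (𝓡 m) F q w) ∉ P := by
    by_contra! hc
    have h1 : ∀ v ∈ P, J (F q) v ∈ P := by
      rintro _ ⟨w, rfl⟩; exact hc w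
    refine hq (le_antisymm ?_ fun v hv => ?_)
    · rintro _ ⟨v, hv, rfl⟩; exact h1 v hv
    · refine ⟨J (F q) (-v), h1 _ (P.neg_mem hv), ?_⟩
      exact (hJ.sq _ _).trans (neg_neg v)
  obtain ⟨f, hf, hPf⟩ := Submodule.exists_le_ker_of_notMem hw
  let f' : Eu m →ₗ[ℝ] ℝ := f
  let f'' : Eu m →L[ℝ] ℝ := LinearMap.toContinuousLinearMap f'
  exact ⟨f'', fun w => hPf ⟨w, rfl⟩, w, hf⟩

/-- The first variation of the metric, by a potential with Hessian `α ⊗ α`, on vectors killed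
by `α`. -/
theorem metric_of_hessian {Θ : DiffForm m 2 M} {J : EndField m M} (hJ : IsAlmostComplex J) {x : M}
    (α : TangentSpace (𝓡 m) x →L[ℝ] ℝ)
    (h : ∀ u v, Θ x ![u, v] = α v * α (J x u) - α u * α (J x v)) {u v : TangentSpace (𝓡 m) x}
    (hu : α u = 0) (hv : α v = 0) : metric Θ J x u v = α (J x u) * α (J x v) := by
  simp only [metric, h, hJ.sq, map_neg, hu, hv]
  ring

/-- If a functional `α` vanishes on the tangent plane of the surface but not on its image under `J`,
then the deformation by the potential with Hessian `α ⊗ α` gives the Gram determinant a positive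
discriminant. -/
theorem discriminant_neg [IsManifold (𝓡 2) ∞ S] {Θ₀ Θ₁ : DiffForm m 2 M} {J : EndField m M}
    (hJ : IsAlmostComplex J) (ht : Tames Θ₀ J) {F : S → M}
    (hF : IsImmersion (m := m) F) {p : S} {y : Eu 2} (hy : y ∈ (extChartAt (𝓡 2) p).target)
    (α : TangentSpace (𝓡 m) (surfaceMap F p y) →L[ℝ] ℝ)
    (h₁ : ∀ u v, Θ₁ (surfaceMap F p y) ![u, v] =
      α v * α (J (surfaceMap F p y) u) - α u * α (J (surfaceMap F p y) v))
    (hα : ∀ i, α (surfaceVec m F p y i) = 0)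
    (hαJ : ∃ i, α (J (surfaceMap F p y) (surfaceVec m F p y i)) ≠ 0) :
    4 * gramDet Θ₁ J F p y * gramDet Θ₀ J F p y - gramMixed Θ₀ Θ₁ J F p y ^ 2 < 0 := by
  set κ : Fin 2 → ℝ := fun i => α (J (surfaceMap F p y) (surfaceVec m F p y i)) with hκ
  have hh : ∀ i j, gramCoeff (metric Θ₁ J) F p y i j = κ i * κ j :=
    fun i j => metric_of_hessian hJ α h₁ (hα i) (hα j)
  -- On the tangent plane the first variation of the metric has rank one.
  have hdet : gramDet Θ₁ J F p y = 0 := by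
    simp only [gramDet, hh]; ring
  have hmix : 0 < gramMixed Θ₀ Θ₁ J F p y := by
    -- The mixed term is the squared norm of the nonzero vector `κ₁ X₀ - κ₀ X₁`.
    have h1 := ht.metric_lin_pos (x := surfaceMap F p y) (u := surfaceVec m F p y 0)
      (v := surfaceVec m F p y 1) (a := κ 1) (b := -κ 0) fun h0 => by
        obtain ⟨h1, h2⟩ := surfaceVec_independent hF hy _ _ h0
        obtain ⟨i, hi⟩ := hαJ
        fin_cases i
        · exact hi (neg_eq_zero.1 h2)
        · exact hi h1
    simp only [gramMixed, hh, gramCoeff_eq]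
    linarith
  rw [hdet]
  nlinarith [sq_pos_of_pos hmix]

end Holomorphic

end SymplecticArea

end

open SymplecticArea in
theorem theorem3p2 (n : ℕ)
    {M : Type*} [TopologicalSpace M] [T2Space M] [CompactSpace M]
    [ChartedSpace (Eu (2 * n)) M] [IsManifold (𝓡 (2 * n)) ∞ M]
    {S : Type*} [TopologicalSpace S] [T2Space S] [CompactSpace S]
    [ChartedSpace (Eu 2) S] [IsManifold (𝓡 2) ∞ S]
    (Ω : DiffForm (2 * n) 2 M) (hΩ : IsSymplectic Ω)
    (J : EndField (2 * n) M) (hJ : IsAlmostComplex J) (hΩJ : IsCompatible Ω J)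
    (F : S → M) (hF : IsImmersion (m := 2 * n) F)
    (ρ : M → ℝ) (hρ : IsCompatibleStablePoint Ω J F ρ) :
    IsJHolomorphic J F := by
  obtain ⟨⟨hρH, hstable⟩, -⟩ := hρ
  by_contra hc
  simp only [IsJHolomorphic, not_forall] at hc
  obtain ⟨q, hq⟩ := hc
  obtain ⟨p, hp⟩ := (chartPartition S).exists_pos_of_mem (Set.mem_univ q)
  have hqs : q ∈ (extChartAt (𝓡 2) p).source := by
    have := chartPartition_isSubordinate S p (subset_tsupport _ (Function.mem_support.2 hp.ne'))
    simpa using this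
  obtain ⟨y, hy, rfl⟩ : ∃ y ∈ (extChartAt (𝓡 2) p).target, (extChartAt (𝓡 2) p).symm y = q :=
    ⟨_, (extChartAt (𝓡 2) p).map_source hqs, (extChartAt (𝓡 2) p).left_inv hqs⟩
  obtain ⟨α, hα, w, hw⟩ := exists_functional hJ hq
  obtain ⟨ψ, hψ, hHess⟩ := exists_potential hJ (surfaceMap F p y) α
  obtain ⟨ε, hε⟩ := exists_isVariation hΩ.smooth hJ hρH hψ
  have hα' : ∀ i, α (surfaceVec (2 * n) F p y i) = 0 := fun i => by
    rw [surfaceVec, modelMFDeriv_surfaceMap hF.1 hy]; exact hα _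
  have hαJ : ∃ i, α (J (surfaceMap F p y) (surfaceVec (2 * n) F p y i)) ≠ 0 := by
    by_contra! h0
    obtain ⟨z, rfl⟩ : ∃ z : Eu 2, modelMFDeriv (m := 2) (extChartAt (𝓡 2) p).symm y z = w :=
      ⟨mfderiv (𝓡 2) 𝓘(ℝ, Eu 2) (extChartAt (𝓡 2) p) ((extChartAt (𝓡 2) p).symm y) w,
        DFunLike.congr_fun (mfderiv_chart_symm_comp hy) w⟩
    let ℓ : Eu (2 * n) →L[ℝ] ℝ := α.comp (J (surfaceMap F p y))
    have h1 : ℓ (modelMFDeriv (surfaceMap F p) y z) = 0 := by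
      rw [surfaceVec_lin, map_add, map_smul, map_smul, show ℓ (surfaceVec (2 * n) F p y 0) = 0 from
        h0 0, show ℓ (surfaceVec (2 * n) F p y 1) = 0 from h0 1, smul_zero, smul_zero, add_zero]
    exact hw ((congrArg ℓ (modelMFDeriv_surfaceMap hF.1 hy z)).symm.trans h1)
  have hneg := second_deriv_area_neg (deform_isCont hΩ.smooth hJ hρH.1)
    (dc_isSmooth hJ hψ).d_isCont hJ hρH.2 hF p hy hp
    (discriminant_neg hJ hρH.2 hF hy α hHess hα' hαJ)
  -- The path `ρ + t ψ` violates the second order condition.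
  have h0 := hstable ε _ hε
  simp only [area, show ∀ t, deform Ω J (fun x => ρ x + t * ψ x) = _ from
    fun t => funext (deform_add_smul Ω hJ hρH.1 hψ t)] at h0
  exact absurd hneg (not_lt.2 h0)
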